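/- Let $N\ge 2$ be an integer and let $R_N:[0,1]\to[0,1]$ be the Rényi-type continued fraction map $R_N(x)=\frac{N}{1-x}-\left\lfloor\frac{N}{1-x}\right\rfloor$ for $x\ne1$, $R_N(1)=0$. Let $$G_N(x)=\frac{1}{\log\frac{N}{N-1}}\,\log\frac{x+N-1}{N-1},\qquad x\in[0,1].$$ Put $u_{N,i}(x)=1-\frac{N}{x+i}$ and, for $g\in C([0,1])$ and $x\in[0,1]$, $$Vg(x)=-\sum_{i\ge N}\left\{\frac{i+1-N}{(x+i)^2}\int_{u_{N,i}(x)}^{u_{N,i+1}(x)}g(s)\,ds+\frac{N(x+N-1)}{(x+i-1)(x+i)^3}\,g(u_{N,i}(x))\right\}.$$ Call a pair $(e,t)$ with $e>0$ and $t\in[0,1]$ admissible if, with $$H(s)=2(s+e+1)^4+e^3N^2(1-2N)(s+1)-e^4N^3,$$ one has $H(0)<0$, $H(1)>0$, $H'(s)>0$ for all $s\in[0,1]$, and $H(t)=0$ (so $t$ is the unique zero of $H$ in $[0,1]$). For an admissible pair $(e,t)$ let $$g(x)=\frac{N}{eNx+(t+1)(1-x)}-\frac{N-1+x}{e(Nx+1-x)+(t+1)(1-x)},\qquad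 \varphi_N=g',$$ $$v_N=\frac{e^2N}{2(e+t+1)^2},\qquad w_N=-\frac1{m},\quad m=\max_{x\in[0,1]}\frac{\varphi_N(x)}{V\varphi_N(x)}.$$ Then admissible pairs exist for every $N\ge 2$, and for every admissible pair $0<v_N<w_N<1$ and the following holds. Let $\mu$ be a Borel probability measure on $[0,1]$ that is absolutely continuous with respect to Lebesgue measure $\lambda$, and suppose that $f^0_N(x)=(x+N-1)\frac{d\mu}{d\lambda}(x)$ (for a suitable version of the density) is in $C^1([0,1])$ with $(f^0_N)'>0$ on $[0,1]$. Put $$\alpha_N=\min_{x\in[0,1]}\frac{-\varphi_N(x)}{(f^0_N)'(x)},\qquad \beta_N=\max_{x\in[0,1]}\frac{-\varphi_N(x)}{(f^0_N)'(x)}.$$ Then for all integers $n\ge1$ and all $x\in[0,1]$, $$\Big(\log\tfrac{N}{N-1}\Big)^2\,\frac N2\,\frac{\alpha_N}{\beta_N}\,\min_{[0,1]}(f^0_N)'\;v_N^n\,G_N(x)(1-G_N(x))\;\le\;|\mu(R_N^n<x)-G_N(x)|$$ $$\le\;\Big(\log\tfrac{N}{N-1}\Big)^2\,\frac N2\,\frac{\beta_N}{\alpha_N}\,\max_{[0,1]}(f^0_N)'\;w_N^n\,G_N(x)(1-G_N(x)).$$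 -/

import Mathlib

open Set MeasureTheory

noncomputable section

namespace RenyiCF

/-- The Rényi-type continued fraction transformation of `[0,1]`. -/
def renyiMap (N : ℕ) (x : ℝ) : ℝ :=
  if x = 1 then 0 else N / (1 - x) - ⌊(N : ℝ) / (1 - x)⌋

/-- The limit distribution function `G_N`, i.e. the distribution function of the invariant
measure of the transformation. -/
def G (N : ℕ) (x : ℝ) : ℝ :=
  Real.log ((x + N - 1) / (N - 1)) / Real.log (N / (N - 1))

/-- The inverse branches `u_{N,i}(x) = 1 - N / (x + i)`, `i ≥ N`. -/
def u (N i : ℕ) (x : ℝ) : ℝ := 1 - N / (x + i)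

/-- The operator `V` on continuous functions on `[0,1]`, i.e. `(U f)' = -V f'` for the
Perron-Frobenius operator `U` of the map under its invariant measure. The sum over `i ≥ N` is written as a sum
over `k : ℕ` with `i = N + k`; it converges absolutely for `x ∈ [0,1]` and continuous `g`. -/
def V (N : ℕ) (g : ℝ → ℝ) (x : ℝ) : ℝ :=
  -∑' k : ℕ,
    ((((N + k : ℕ) : ℝ) + 1 - N) / (x + (N + k : ℕ)) ^ 2 *
        (∫ t in (u N (N + k) x)..(u N (N + k + 1) x), g t) +
      N * (x + N - 1) / ((x + (N + k : ℕ) - 1) * (x + (N + k : ℕ)) ^ 3) * g (u N (N + k) x))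

/-- The polynomial `H_N` (in the variable `t`, with the coefficient `e`). -/
def H (N : ℕ) (e t : ℝ) : ℝ :=
  2 * (t + e + 1) ^ 4 + e ^ 3 * N ^ 2 * (1 - 2 * N) * (t + 1) - e ^ 4 * N ^ 3

/-- `(e, t)` is an admissible choice of `(e_N, t_N)`: the coefficient `e > 0` is such that
`H_N(0) < 0`, `H_N(1) > 0` and `H_N' > 0` on `[0,1]`, and `t` is the (then unique) zero of `H_N`
in `[0,1]`. -/
structure Admissible (N : ℕ) (e t : ℝ) : Prop where
  e_pos : 0 < e
  H_zero : H N e 0 < 0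
  H_one : 0 < H N e 1
  deriv_pos : ∀ s ∈ Icc (0 : ℝ) 1, 0 < deriv (H N e) s
  t_mem : t ∈ Icc (0 : ℝ) 1
  root : H N e t = 0

/-- The function `g_{N,t}`, i.e. `N/(1-x) h(Nx/(1-x)) - (N/(1-x) - 1) h(Nx/(1-x) + 1)` with
`h(y) = 1 / (e y + t + 1)`, after clearing denominators. -/
def gfun (N : ℕ) (e t x : ℝ) : ℝ :=
  N / (e * N * x + (t + 1) * (1 - x)) -
    (N - 1 + x) / (e * (N * x + 1 - x) + (t + 1) * (1 - x))

/-- The function `φ_{N,t}`, the derivative of `g_{N,t}`. -/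
def phi (N : ℕ) (e t x : ℝ) : ℝ := deriv (gfun N e t) x

/-- Minimum over `[0,1]` (attained for continuous functions). -/
def minI (f : ℝ → ℝ) : ℝ := sInf (f '' Icc 0 1)

/-- Maximum over `[0,1]` (attained for continuous functions). -/
def maxI (f : ℝ → ℝ) : ℝ := sSup (f '' Icc 0 1)

/-- `v_N = e² N / (2 (e + t + 1)²)`. -/
def v (N : ℕ) (e t : ℝ) : ℝ := e ^ 2 * N / (2 * (e + t + 1) ^ 2)

/-- `w_N = -1 / m`, where `m` is the maximum of `φ / V φ` over `[0,1]`. -/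
def w (N : ℕ) (e t : ℝ) : ℝ := -1 / maxI (fun x => phi N e t x / V N (phi N e t) x)

/-- `α_N = min (-φ / f')`, where `f'` is the derivative of `f` on `[0,1]`. -/
def alpha (N : ℕ) (e t : ℝ) (f : ℝ → ℝ) : ℝ :=
  minI (fun x => -phi N e t x / derivWithin f (Icc 0 1) x)

/-- `β_N = max (-φ / f')`, where `f'` is the derivative of `f` on `[0,1]`. -/
def beta (N : ℕ) (e t : ℝ) (f : ℝ → ℝ) : ℝ :=
  maxI (fun x => -phi N e t x / derivWithin f (Icc 0 1) x)

end RenyiCF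

end

/-!
Let `U` be the Perron-Frobenius operator of the map under its invariant measure (`transfer`). The
distribution function of the `n`-th iterate has the density `U^n f(y) / (y + N - 1)`
(`measureReal_iterate_lt`), so in the variable `s = G_N(x)` its deviation from `s` vanishes at both
ends and has a second derivative proportional to `(x + N - 1) (U^n f)'(x)`. One-sided bounds for
this quantity bound the deviation by a multiple of `s (1 - s)` (`deviation_le_of_monotoneOn`).

The derivatives of the iterates need not be computed. `U` preserves monotone functions
(`monotoneOn_transfer`): the inverse branches increase, and so do the tails of the weights. This is
the positivity of `-V`, and a bound `f' ≤ -c φ` can be read as monotonicity of `-f - c g`, which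
passes to the images under `U`. Since `g` is a preimage under `U` of `h(x) = 1 / (e x + t + 1)`
(`transfer_gfun`), iterating only needs `v (-φ) ≤ -h' ≤ w (-φ)`, where `-h' = Vφ` (`V_phi`).

The quotient `-φ / Vφ` is a combination of two squares of Möbius functions and depends on `(e, t)`
through `y = (t + 1) / e` alone (`quot`). The equation `H_N(t) = 0` says that its values at `0` and `1`
agree, their common value being `1 / v_N`; it also forces `N - 4/3 < y < N - 1`, and in that range
the coefficients are positive and both squares lie strictly below their chords, whence `v_N < w_N`. The same range gives
`w_N < 1`, and it makes `(x + N - 1) Vφ(x)` least at `x = 1` (`density_mul_V_phi_ge`), which is why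
the lower estimate holds with the factor `N / 2` in place of `(N - 1) / 2`.
-/

noncomputable section

namespace RenyiCF

/-! ### The ratio `(t + 1) / e` -/

/-- `H_N` is homogeneous in `(e, t + 1)`, so `y = (t + 1) / e` solves this equation in `y` alone. -/
theorem Admissible.ratio_root {N : ℕ} {e t : ℝ} (h : Admissible N e t) :
    2 * (1 + (t + 1) / e) ^ 4 = (N : ℝ) ^ 3 + (2 * N - 1) * N ^ 2 * ((t + 1) / e) := by
  have he := h.e_pos
  have h1 := h.root
  unfold H at h1
  field_simp
  linear_combination h1

theorem ratio_gt {n y : ℝ} (hn : 2 ≤ n) (hy : 0 < y)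
    (h : 2 * (1 + y) ^ 4 = n ^ 3 + (2 * n - 1) * n ^ 2 * y) : n - 4 / 3 < y := by
  by_contra! hc
  -- the chord of the convex quartic over `[0, n - 4/3]` is negative at both ends
  have hq0 : 2 - n ^ 3 < 0 := by nlinarith [sq_nonneg n, sq_nonneg (n - 2)]
  have hqc : 2 * (1 + (n - 4 / 3)) ^ 4 - (n ^ 3 + (2 * n - 1) * n ^ 2 * (n - 4 / 3)) < 0 := by
    nlinarith
  have hr : y ^ 3 + 4 * y ^ 2 + 6 * y ≤
      (n - 4 / 3) ^ 3 + 4 * (n - 4 / 3) ^ 2 + 6 * (n - 4 / 3) := by gcongr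
  set c := n - 4 / 3 with hcdef
  have hc0 : 0 < c := by linarith
  have h1 : 0 ≤ c * y * (c ^ 3 + 4 * c ^ 2 + 6 * c - (y ^ 3 + 4 * y ^ 2 + 6 * y)) :=
    mul_nonneg (by positivity) (by linarith)
  nlinarith [mul_pos hy (neg_pos.2 hqc), mul_nonneg (sub_nonneg.2 hc) (neg_pos.2 hq0).le,
    congrArg (fun z => c * z) h]

theorem ratio_lt {n y : ℝ} (hn : 2 ≤ n)
    (h : 2 * (1 + y) ^ 4 = n ^ 3 + (2 * n - 1) * n ^ 2 * y) : y < n - 1 := by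
  by_contra! hc
  have hq0 : 2 - n ^ 3 < 0 := by nlinarith [sq_nonneg n, sq_nonneg (n - 2)]
  have hqc : 0 < 2 * (1 + (n - 1)) ^ 4 - (n ^ 3 + (2 * n - 1) * n ^ 2 * (n - 1)) := by
    have : 0 < n ^ 2 * (2 * n - 1) := mul_pos (by positivity) (by linarith)
    nlinarith
  have hr : (n - 1) ^ 3 + 4 * (n - 1) ^ 2 + 6 * (n - 1) ≤ y ^ 3 + 4 * y ^ 2 + 6 * y := by
    have : 0 ≤ n - 1 := by linarith
    gcongr
  set c := n - 1 with hcdef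
  have hc0 : 0 < c := by linarith
  have hy : 0 < y := by linarith
  have h1 : 0 ≤ c * y * (y ^ 3 + 4 * y ^ 2 + 6 * y - (c ^ 3 + 4 * c ^ 2 + 6 * c)) :=
    mul_nonneg (by positivity) (by linarith)
  nlinarith [mul_pos hy hqc, mul_nonneg (sub_nonneg.2 hc) (neg_pos.2 hq0).le,
    congrArg (fun z => c * z) h]

theorem exists_ratio {n : ℝ} (hn : 2 ≤ n) :
    ∃ y, 0 < y ∧ 2 * (1 + y) ^ 4 = n ^ 3 + (2 * n - 1) * n ^ 2 * y := by
  have hcont : ContinuousOn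
      (fun y : ℝ => 2 * (1 + y) ^ 4 - (n ^ 3 + (2 * n - 1) * n ^ 2 * y)) (Icc (n - 4 / 3) (n - 1)) := by
    fun_prop
  have hmem : (0 : ℝ) ∈ Icc
      (2 * (1 + (n - 4 / 3)) ^ 4 - (n ^ 3 + (2 * n - 1) * n ^ 2 * (n - 4 / 3)))
      (2 * (1 + (n - 1)) ^ 4 - (n ^ 3 + (2 * n - 1) * n ^ 2 * (n - 1))) := by
    have : 0 < n ^ 2 * (2 * n - 1) := mul_pos (by positivity) (by linarith)
    constructor <;> nlinarith
  obtain ⟨y, hy, h0⟩ := intermediate_value_Icc (by linarith) hcont hmem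
  exact ⟨y, by linarith [hy.1], by simpa [sub_eq_zero] using h0⟩

theorem hasDerivAt_H (N : ℕ) (e s : ℝ) :
    HasDerivAt (H N e) (8 * (s + e + 1) ^ 3 + e ^ 3 * N ^ 2 * (1 - 2 * N)) s := by
  unfold H
  have h1 : HasDerivAt (fun s : ℝ => s + e + 1) 1 s := ((hasDerivAt_id s).add_const e).add_const 1
  have h2 : HasDerivAt (fun s : ℝ => s + 1) 1 s := (hasDerivAt_id s).add_const 1
  have h3 := (((h1.pow 4).const_mul 2).add
    (h2.const_mul (e ^ 3 * N ^ 2 * (1 - 2 * N)))).sub_const (e ^ 4 * (N : ℝ) ^ 3)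
  refine h3.congr_deriv ?_
  norm_num
  ring

theorem exists_admissible (N : ℕ) (hN : 2 ≤ N) : ∃ e t : ℝ, Admissible N e t := by
  have hn : (2 : ℝ) ≤ N := by exact_mod_cast hN
  obtain ⟨y, hy, h⟩ := exists_ratio hn
  have hlo := ratio_gt hn hy h
  generalize hnN : (N : ℝ) = n at *
  have hq0 : 2 < n ^ 3 := by nlinarith [sq_nonneg n, sq_nonneg (n - 2)]
  -- `t = 1/2` makes `s + 1` range over `[2/3, 4/3]` times `t + 1`
  refine ⟨3 / 2 / y, 1 / 2, by positivity, ?_, ?_, ?_, by norm_num, ?_⟩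
  · unfold H
    rw [hnN]
    field_simp
    nlinarith [pow_pos hy 2, pow_pos hy 3, pow_pos hy 4]
  · unfold H
    rw [hnN]
    field_simp
    nlinarith [pow_pos hy 2, pow_pos hy 3, pow_pos hy 4]
  · intro s hs
    rw [(hasDerivAt_H N _ s).deriv, hnN]
    have h1 : (3 / 2 / y * (1 + 2 * y / 3)) ^ 3 ≤ (s + 3 / 2 / y + 1) ^ 3 := by
      have : 3 / 2 / y * (1 + 2 * y / 3) = 3 / 2 / y + 1 := by field_simp
      have h3 : 0 < 3 / 2 / y := by positivity
      gcongr
      linarith [hs.1]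
    have h2 : (2 * n / 3) ^ 3 ≤ (1 + 2 * y / 3) ^ 3 := by
      gcongr
      linarith
    have h3 : 0 < (3 / 2 / y) ^ 3 := by positivity
    have h4 : n ^ 2 * (2 * n - 1) < 8 * (1 + 2 * y / 3) ^ 3 := by
      have : 0 < n ^ 2 := by positivity
      have : 0 < n ^ 3 := by positivity
      nlinarith
    rw [mul_pow] at h1
    nlinarith [mul_lt_mul_of_pos_left h4 h3]
  · unfold H
    rw [hnN]
    field_simp
    linear_combination (27 * 3 * h)

/-! ### The quotient `φ / Vφ` -/

/-- The square of a Möbius function `(x + y) / (p + d x)` lies below its chord over `[0, 1]` when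
the linear factor of the difference has the sign of the determinant `p - d y` at both ends. -/
theorem sq_mobius_lt_chord {y p d x : ℝ} (hp : 0 < p) (hpd : 0 < p + d) (hx : x ∈ Ioo (0 : ℝ) 1)
    (h0 : 0 < (p - d * y) * (p ^ 2 - 3 * y * p * d - 2 * y * d ^ 2))
    (h1 : 0 < (p - d * y) * (p ^ 2 - 3 * y * p * d - d * p - y * d ^ 2)) :
    ((x + y) / (p + d * x)) ^ 2 < (1 - x) * (y / p) ^ 2 + x * ((1 + y) / (p + d)) ^ 2 := by
  obtain ⟨hx0, hx1⟩ := hx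
  have hB : 0 < p + d * x := by
    nlinarith [mul_pos hp (sub_pos.2 hx1), mul_pos hpd hx0]
  have hB' : p + x * d ≠ 0 := by rw [mul_comm x]; exact hB.ne'
  rw [← sub_pos]
  have key : (1 - x) * (y / p) ^ 2 + x * ((1 + y) / (p + d)) ^ 2 - ((x + y) / (p + d * x)) ^ 2 =
      x * (1 - x) *
        ((1 - x) * (p * ((p - d * y) * (p ^ 2 - 3 * y * p * d - 2 * y * d ^ 2))) +
          x * ((p + d) * ((p - d * y) * (p ^ 2 - 3 * y * p * d - d * p - y * d ^ 2)))) /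
        ((p + d * x) ^ 2 * p ^ 2 * (p + d) ^ 2) := by
    field_simp
    ring
  rw [key]
  have : 0 < 1 - x := by linarith
  positivity

/-- The quotient `-φ / Vφ` on `[0, 1]`, which depends on `(e, t)` only through `y = (t + 1) / e`. -/
def quot (n y x : ℝ) : ℝ :=
  n * ((n - y) * ((x + y) / (y + (n - y) * x)) ^ 2 +
    (y - n + 2) * ((x + y) / (1 + y + (n - 1 - y) * x)) ^ 2)

theorem quot_one {n y : ℝ} (hn : 2 ≤ n) : quot n y 1 = 2 * (1 + y) ^ 2 / n := by
  unfold quot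
  have h1 : y + (n - y) * 1 = n := by ring
  have h2 : 1 + y + (n - 1 - y) * 1 = n := by ring
  rw [h1, h2]
  field_simp
  ring

theorem quot_zero {n y : ℝ} (hn : 2 ≤ n) (hy : 0 < y)
    (h : 2 * (1 + y) ^ 4 = n ^ 3 + (2 * n - 1) * n ^ 2 * y) :
    quot n y 0 = 2 * (1 + y) ^ 2 / n := by
  unfold quot
  simp only [mul_zero, add_zero, zero_add]
  field_simp
  linear_combination -h

theorem quot_lt {n y x : ℝ} (hn : 2 ≤ n) (hy : 0 < y)
    (h : 2 * (1 + y) ^ 4 = n ^ 3 + (2 * n - 1) * n ^ 2 * y) (hx : x ∈ Ioo (0 : ℝ) 1) :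
    quot n y x < 2 * (1 + y) ^ 2 / n := by
  have hlo := ratio_gt hn hy h
  have hhi := ratio_lt hn h
  have h1 := sq_mobius_lt_chord (y := y) (p := y) (d := n - y) hy (by linarith) hx
    (by
      apply mul_pos_of_neg_of_neg
      · nlinarith
      · nlinarith [mul_pos hy hy, mul_pos hy (show 0 < n - y by linarith), sq_nonneg (n - y)])
    (by
      apply mul_pos_of_neg_of_neg
      · nlinarith
      · nlinarith [mul_pos hy hy, mul_pos hy (show 0 < n - y by linarith), sq_nonneg (n - y)])
  have h2 := sq_mobius_lt_chord (y := y) (p := 1 + y) (d := n - 1 - y) (by linarith)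
    (by linarith) hx
    (by
      have hd : n - 1 - y ≤ 1 / 3 := by linarith
      have hd0 : 0 < n - 1 - y := by linarith
      generalize n - 1 - y = d at *
      have : d ^ 2 ≤ 1 / 9 := by nlinarith
      apply mul_pos <;> nlinarith [mul_nonneg hy.le (sub_nonneg.2 hd),
        mul_nonneg hy.le (sub_nonneg.2 this),
        mul_nonneg (mul_nonneg hy.le (by linarith : (0 : ℝ) ≤ 1 + y)) (sub_nonneg.2 hd)])
    (by
      have hd : n - 1 - y ≤ 1 / 3 := by linarith
      have hd0 : 0 < n - 1 - y := by linarith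
      generalize n - 1 - y = d at *
      have : d ^ 2 ≤ 1 / 9 := by nlinarith
      apply mul_pos <;> nlinarith [mul_nonneg hy.le (sub_nonneg.2 hd),
        mul_nonneg hy.le (sub_nonneg.2 this),
        mul_nonneg (mul_nonneg hy.le (by linarith : (0 : ℝ) ≤ 1 + y)) (sub_nonneg.2 hd)])
  have h3 : quot n y x < (1 - x) * quot n y 0 + x * quot n y 1 := by
    unfold quot
    simp only [mul_zero, add_zero, zero_add, mul_one]
    have ha : 0 < n - y := by linarith
    have hb : 0 < y - n + 2 := by linarith
    have := add_lt_add (mul_lt_mul_of_pos_left h1 ha) (mul_lt_mul_of_pos_left h2 hb)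
    nlinarith [mul_lt_mul_of_pos_left this (show 0 < n by linarith)]
  rw [quot_zero hn hy h, quot_one hn] at h3
  linarith

theorem quot_le {n y x : ℝ} (hn : 2 ≤ n) (hy : 0 < y)
    (h : 2 * (1 + y) ^ 4 = n ^ 3 + (2 * n - 1) * n ^ 2 * y) (hx : x ∈ Icc (0 : ℝ) 1) :
    quot n y x ≤ 2 * (1 + y) ^ 2 / n := by
  rcases hx.1.eq_or_lt with rfl | h0
  · exact (quot_zero hn hy h).le
  rcases hx.2.eq_or_lt with rfl | h1
  · exact (quot_one hn).le
  exact (quot_lt hn hy h ⟨h0, h1⟩).le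

theorem one_lt_quot {n y x : ℝ} (hn : 2 ≤ n) (hy : 0 < y)
    (h : 2 * (1 + y) ^ 4 = n ^ 3 + (2 * n - 1) * n ^ 2 * y) (hx : x ∈ Icc (0 : ℝ) 1) :
    1 < quot n y x := by
  have hlo := ratio_gt hn hy h
  have hhi := ratio_lt hn h
  have hden : 0 < y + (n - y) * x := by nlinarith [hx.1]
  -- the first Möbius function decreases on `[0, 1]`, from `1` to `(1 + y) / n`
  have h1 : (1 + y) / n ≤ (x + y) / (y + (n - y) * x) := by
    rw [div_le_div_iff₀ (by linarith) hden]
    nlinarith [mul_nonneg (sub_nonneg.2 hx.2) (mul_nonneg hy.le (sub_nonneg.2 hhi.le))]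
  have h2 : ((1 + y) / n) ^ 2 ≤ ((x + y) / (y + (n - y) * x)) ^ 2 := by gcongr
  have h3 : 1 < n * ((1 + y) / n) ^ 2 := by
    rw [div_pow, ← mul_div_assoc, lt_div_iff₀ (by positivity)]
    nlinarith
  have h4 : 0 ≤ (y - n + 2) * ((x + y) / (1 + y + (n - 1 - y) * x)) ^ 2 :=
    mul_nonneg (by linarith) (sq_nonneg _)
  have h5 : ((1 + y) / n) ^ 2 ≤ (n - y) * ((x + y) / (y + (n - y) * x)) ^ 2 := by
    nlinarith [sq_nonneg ((x + y) / (y + (n - y) * x))]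
  unfold quot
  nlinarith

/-! ### The functions `g` and `φ` -/

section Gfun

variable {N : ℕ} {e t : ℝ}

theorem gfun_den_pos (hN : 2 ≤ N) (he : 0 < e) (ht : 0 ≤ t) {x : ℝ} (hx : x ∈ Icc (0 : ℝ) 1) :
    0 < e * N * x + (t + 1) * (1 - x) ∧ 0 < e * (N * x + 1 - x) + (t + 1) * (1 - x) := by
  have hn : (2 : ℝ) ≤ N := by exact_mod_cast hN
  obtain ⟨h0, h1⟩ := hx
  rcases h0.eq_or_lt with rfl | h0
  · constructor <;> norm_num <;> linarith
  have h3 : 0 ≤ (t + 1) * (1 - x) := mul_nonneg (by linarith) (by linarith)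
  have h4 : 0 < e * N * x := by positivity
  have h5 : 0 < e * (N * x + 1 - x) := mul_pos he (by nlinarith)
  constructor <;> linarith

theorem hasDerivAt_gfun (hN : 2 ≤ N) (he : 0 < e) (ht : 0 ≤ t) {x : ℝ} (hx : x ∈ Icc (0 : ℝ) 1) :
    HasDerivAt (gfun N e t)
      (-(N * (e * N - (t + 1)) / (e * N * x + (t + 1) * (1 - x)) ^ 2 +
        N * (t + 1 - e * (N - 2)) / (e * (N * x + 1 - x) + (t + 1) * (1 - x)) ^ 2)) x := by
  obtain ⟨hA, hB⟩ := gfun_den_pos hN he ht hx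
  have h1 : HasDerivAt (fun x : ℝ => e * N * x + (t + 1) * (1 - x)) (e * N - (t + 1)) x := by
    refine (((hasDerivAt_id x).const_mul (e * N)).add
      (((hasDerivAt_id x).const_sub 1).const_mul (t + 1))).congr_deriv ?_
    ring
  have h2 : HasDerivAt (fun x : ℝ => e * (N * x + 1 - x) + (t + 1) * (1 - x))
      (e * (N - 1) - (t + 1)) x := by
    refine ((((((hasDerivAt_id x).const_mul (N : ℝ)).add_const 1).sub
      (hasDerivAt_id x)).const_mul e).add
      (((hasDerivAt_id x).const_sub 1).const_mul (t + 1))).congr_deriv ?_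
    ring
  refine (((hasDerivAt_const x (N : ℝ)).div h1 hA.ne').sub
    (((hasDerivAt_id x).const_add ((N : ℝ) - 1)).div h2 hB.ne')).congr_deriv ?_
  have hA' := hA.ne'
  have hB' := hB.ne'
  simp only [id]
  generalize hAA : e * N * x + (t + 1) * (1 - x) = A at *
  generalize hBB : e * (N * x + 1 - x) + (t + 1) * (1 - x) = B at *
  field_simp
  rw [← hBB]
  ring

theorem phi_eq (hN : 2 ≤ N) (he : 0 < e) (ht : 0 ≤ t) {x : ℝ} (hx : x ∈ Icc (0 : ℝ) 1) :
    phi N e t x = -(N * (e * N - (t + 1)) / (e * N * x + (t + 1) * (1 - x)) ^ 2 +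
        N * (t + 1 - e * (N - 2)) / (e * (N * x + 1 - x) + (t + 1) * (1 - x)) ^ 2) :=
  (hasDerivAt_gfun hN he ht hx).deriv

theorem hasDerivAt_gfun_phi (hN : 2 ≤ N) (he : 0 < e) (ht : 0 ≤ t) {x : ℝ}
    (hx : x ∈ Icc (0 : ℝ) 1) : HasDerivAt (gfun N e t) (phi N e t x) x :=
  (hasDerivAt_gfun hN he ht hx).differentiableAt.hasDerivAt

theorem continuousOn_phi (hN : 2 ≤ N) (he : 0 < e) (ht : 0 ≤ t) :
    ContinuousOn (phi N e t) (Icc 0 1) := by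
  refine ContinuousOn.congr ?_ (fun x hx => phi_eq hN he ht hx)
  refine (ContinuousOn.add ?_ ?_).neg
  · refine ContinuousOn.div (by fun_prop) (by fun_prop) fun x hx => ?_
    have := (gfun_den_pos hN he ht hx).1
    positivity
  · refine ContinuousOn.div (by fun_prop) (by fun_prop) fun x hx => ?_
    have := (gfun_den_pos hN he ht hx).2
    positivity

theorem neg_phi_eq_quot (hN : 2 ≤ N) (he : 0 < e) (ht : 0 ≤ t) {x : ℝ} (hx : x ∈ Icc (0 : ℝ) 1) :
    -phi N e t x = quot N ((t + 1) / e) x * (e / (e * x + (t + 1)) ^ 2) := by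
  obtain ⟨hA, hB⟩ := gfun_den_pos hN he ht hx
  rw [phi_eq hN he ht hx, quot]
  have hT : 0 < e * x + (t + 1) := by nlinarith [hx.1]
  have h1 : (t + 1) / e + (N - (t + 1) / e) * x =
      (e * N * x + (t + 1) * (1 - x)) / e := by field_simp; ring
  have h2 : 1 + (t + 1) / e + (N - 1 - (t + 1) / e) * x =
      (e * (N * x + 1 - x) + (t + 1) * (1 - x)) / e := by field_simp; ring
  have h3 : x + (t + 1) / e = (e * x + (t + 1)) / e := by field_simp
  rw [h1, h2, h3]
  have hA' := hA.ne'
  have hB' := hB.ne'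
  have hT' := hT.ne'
  generalize e * N * x + (t + 1) * (1 - x) = A at *
  generalize e * (N * x + 1 - x) + (t + 1) * (1 - x) = B at *
  generalize e * x + (t + 1) = C at *
  field_simp
  ring

end Gfun

/-! ### The inverse branches -/

theorem branch_den_pos {N : ℕ} (hN : 2 ≤ N) (k : ℕ) {x : ℝ} (hx : 0 ≤ x) :
    0 < x + (N + k : ℕ) - 1 := by
  have hn : (2 : ℝ) ≤ N := by exact_mod_cast hN
  have : (0 : ℝ) ≤ k := k.cast_nonneg
  push_cast
  linarith

theorem u_mem {N : ℕ} (hN : 2 ≤ N) (k : ℕ) {x : ℝ} (hx : 0 ≤ x) : u N (N + k) x ∈ Icc (0 : ℝ) 1 := by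
  have h := branch_den_pos hN k hx
  have : (0 : ℝ) ≤ k := k.cast_nonneg
  unfold u
  constructor
  · rw [sub_nonneg, div_le_one (by linarith)]
    push_cast
    linarith
  · have : (0 : ℝ) ≤ N / (x + (N + k : ℕ)) := div_nonneg N.cast_nonneg (by linarith)
    linarith

theorem u_le_u {N : ℕ} (hN : 2 ≤ N) (k : ℕ) {x y : ℝ} (hx : 0 ≤ x) (hxy : x ≤ y) :
    u N (N + k) x ≤ u N (N + k) y := by
  have h := branch_den_pos hN k hx
  unfold u
  have : (N : ℝ) / (y + (N + k : ℕ)) ≤ N / (x + (N + k : ℕ)) := by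
    gcongr
  linarith

theorem u_succ_le {N : ℕ} (hN : 2 ≤ N) (k : ℕ) {x : ℝ} (hx : 0 ≤ x) :
    u N (N + k) x ≤ u N (N + (k + 1)) x := by
  have h := branch_den_pos hN k hx
  unfold u
  have : (N : ℝ) / (x + (N + (k + 1) : ℕ)) ≤ N / (x + (N + k : ℕ)) := by
    gcongr
    simp
  linarith

/-! ### The value of `Vφ` -/

section Vphi

variable {N : ℕ} {e t : ℝ}

/-- The substitution behind `g`: with `h(y) = 1 / (e y + t + 1)` and `z = x + N + k`,
`g (u x) = z h(x + k) - (z - 1) h(x + k + 1)`, which telescopes against the branch weights. -/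
theorem gfun_u (hN : 2 ≤ N) (he : 0 < e) (ht : 0 ≤ t) (k : ℕ) {x : ℝ} (hx : 0 ≤ x) :
    gfun N e t (u N (N + k) x) = (x + N + k) / (e * (x + k) + (t + 1)) -
      (x + N + k - 1) / (e * (x + k + 1) + (t + 1)) := by
  have hn : (2 : ℝ) ≤ N := by exact_mod_cast hN
  have hk : (0 : ℝ) ≤ k := k.cast_nonneg
  have hz : 0 < x + N + k := by linarith
  have ha : 0 < e * (x + k) + (t + 1) := by positivity
  have hb : 0 < e * (x + k + 1) + (t + 1) := by positivity
  unfold gfun u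
  push_cast
  rw [← add_assoc]
  have h1 : e * N * (1 - N / (x + N + k)) + (t + 1) * (1 - (1 - N / (x + N + k))) =
      N * (e * (x + k) + (t + 1)) / (x + N + k) := by field_simp; ring
  have h2 : e * (N * (1 - N / (x + N + k)) + 1 - (1 - N / (x + N + k))) +
      (t + 1) * (1 - (1 - N / (x + N + k))) =
      N * (e * (x + k + 1) + (t + 1)) / (x + N + k) := by field_simp; ring
  rw [h1, h2]
  field_simp
  ring

theorem phi_u (hN : 2 ≤ N) (he : 0 < e) (ht : 0 ≤ t) (k : ℕ) {x : ℝ} (hx : 0 ≤ x) :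
    phi N e t (u N (N + k) x) = -((x + N + k) ^ 2 / N) *
      ((e * N - (t + 1)) / (e * (x + k) + (t + 1)) ^ 2 +
        (t + 1 - e * (N - 2)) / (e * (x + k + 1) + (t + 1)) ^ 2) := by
  have hn : (2 : ℝ) ≤ N := by exact_mod_cast hN
  have hk : (0 : ℝ) ≤ k := k.cast_nonneg
  have hz : 0 < x + N + k := by linarith
  have ha : 0 < e * (x + k) + (t + 1) := by positivity
  have hb : 0 < e * (x + k + 1) + (t + 1) := by positivity
  rw [phi_eq hN he ht (u_mem hN k hx)]
  unfold u
  push_cast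
  rw [← add_assoc]
  have h1 : e * N * (1 - N / (x + N + k)) + (t + 1) * (1 - (1 - N / (x + N + k))) =
      N * (e * (x + k) + (t + 1)) / (x + N + k) := by field_simp; ring
  have h2 : e * (N * (1 - N / (x + N + k)) + 1 - (1 - N / (x + N + k))) +
      (t + 1) * (1 - (1 - N / (x + N + k))) =
      N * (e * (x + k + 1) + (t + 1)) / (x + N + k) := by field_simp; ring
  rw [h1, h2]
  field_simp

theorem integral_phi (hN : 2 ≤ N) (he : 0 < e) (ht : 0 ≤ t) {a b : ℝ} (ha : a ∈ Icc (0 : ℝ) 1)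
    (hb : b ∈ Icc (0 : ℝ) 1) : ∫ s in a..b, phi N e t s = gfun N e t b - gfun N e t a := by
  have hsub : uIcc a b ⊆ Icc 0 1 := uIcc_subset_Icc ha hb
  exact intervalIntegral.integral_eq_sub_of_hasDerivAt
    (fun s hs => hasDerivAt_gfun_phi hN he ht (hsub hs))
    ((continuousOn_phi hN he ht).mono hsub).intervalIntegrable

/-- The terms of the series for `Vφ` are the differences of
`Q_k' - k / (x + N + k - 1)² g(u_k)`, where `Q_k = (x + N - 1) h(x + k) / (x + N + k - 1)` are the
tails of the series for the Perron-Frobenius operator. -/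
theorem V_phi_term (hN : 2 ≤ N) (he : 0 < e) (ht : 0 ≤ t) (k : ℕ) {x : ℝ} (hx : 0 ≤ x) {S : ℕ → ℝ}
    (hS : ∀ k : ℕ, S k =
      k / ((x + N + k - 1) ^ 2 * (e * (x + k) + (t + 1))) -
        (x + N - 1) * e / ((x + N + k - 1) * (e * (x + k) + (t + 1)) ^ 2) -
        k / (x + N + k - 1) ^ 2 * ((x + N + k) / (e * (x + k) + (t + 1)) -
          (x + N + k - 1) / (e * (x + k + 1) + (t + 1)))) :
    (((N + k : ℕ) : ℝ) + 1 - N) / (x + (N + k : ℕ)) ^ 2 *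
        (∫ s in (u N (N + k) x)..(u N (N + k + 1) x), phi N e t s) +
      N * (x + N - 1) / ((x + (N + k : ℕ) - 1) * (x + (N + k : ℕ)) ^ 3) *
        phi N e t (u N (N + k) x) = S k - S (k + 1) := by
  have hn : (2 : ℝ) ≤ N := by exact_mod_cast hN
  have hk : (0 : ℝ) ≤ k := k.cast_nonneg
  rw [add_assoc N k 1, integral_phi hN he ht (u_mem hN k hx) (u_mem hN (k + 1) hx),
    gfun_u hN he ht k hx, gfun_u hN he ht (k + 1) hx, phi_u hN he ht k hx, hS, hS]
  push_cast
  generalize ht' : t + 1 = T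
  have hT : 0 < T := by linarith
  have hz : 0 < x + N + k := by linarith
  have hm : 0 < x + N + k - 1 := by linarith
  have hz' : x + (N + k) = x + N + k := by ring
  have hz'' : x + N + (k + 1) = x + N + k + 1 := by ring
  have hz3 : x + N + k + 1 - 1 = x + N + k := by ring
  have ha : 0 < e * (x + k) + T := by positivity
  have hb : e * (x + k + 1) + T = e * (x + k) + T + e := by ring
  have hb' : e * (x + (k + 1)) + T = e * (x + k) + T + e := by ring
  have hc : e * (x + (k + 1) + 1) + T = e * (x + k) + T + 2 * e := by ring
  rw [hz', hz'', hz3, hb, hb', hc]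
  have hTT : T = (e * (x + k) + T) - e * (x + k) := by ring
  generalize e * (x + k) + T = A at *
  subst hTT
  have hx' : x = (x + N + k) - N - k := by ring
  generalize x + N + k = z at *
  subst hx'
  have h1 : A + e ≠ 0 := by positivity
  have h2 : A + 2 * e ≠ 0 := by positivity
  have h3 := hm.ne'
  field_simp
  ring

theorem phi_neg (hN : 2 ≤ N) (h : Admissible N e t) {x : ℝ} (hx : x ∈ Icc (0 : ℝ) 1) :
    phi N e t x < 0 := by
  have hn : (2 : ℝ) ≤ N := by exact_mod_cast hN
  have hT : 0 < t + 1 := by linarith [h.t_mem.1]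
  have he := h.e_pos
  have hq := one_lt_quot hn (div_pos hT he) h.ratio_root hx
  have hx0 := hx.1
  have := neg_phi_eq_quot hN he h.t_mem.1 hx
  have h2 : 0 < quot N ((t + 1) / e) x * (e / (e * x + (t + 1)) ^ 2) := by
    have : 0 < quot N ((t + 1) / e) x := by linarith
    positivity
  linarith

theorem V_phi (hN : 2 ≤ N) (h : Admissible N e t) {x : ℝ} (hx : x ∈ Icc (0 : ℝ) 1) :
    V N (phi N e t) x = e / (e * x + (t + 1)) ^ 2 := by
  have hn : (2 : ℝ) ≤ N := by exact_mod_cast hN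
  have ht := h.t_mem.1
  have hT : 0 < t + 1 := by linarith
  have he := h.e_pos
  have hx0 := hx.1
  obtain ⟨S, hS⟩ : ∃ S : ℕ → ℝ, ∀ k : ℕ, S k =
      k / ((x + N + k - 1) ^ 2 * (e * (x + k) + (t + 1))) -
        (x + N - 1) * e / ((x + N + k - 1) * (e * (x + k) + (t + 1)) ^ 2) -
        k / (x + N + k - 1) ^ 2 * ((x + N + k) / (e * (x + k) + (t + 1)) -
          (x + N + k - 1) / (e * (x + k + 1) + (t + 1))) := ⟨_, fun _ => rfl⟩
  have hterm := fun k => V_phi_term hN he ht k hx0 hS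
  have hS0 : S 0 = -(e / (e * x + (t + 1)) ^ 2) := by
    rw [hS]
    have : x + N - 1 ≠ 0 := by linarith
    simp
    field_simp
  have hlim : Filter.Tendsto S Filter.atTop (nhds 0) := by
    have hden : Filter.Tendsto (fun k : ℕ => 2 * (e / (t + 1)) * (e * (x + k) + (t + 1))⁻¹)
        Filter.atTop (nhds 0) := by
      rw [← mul_zero (2 * (e / (t + 1)))]
      refine (tendsto_inv_atTop_zero.comp ?_).const_mul _
      refine Filter.tendsto_atTop_add_const_right _ _ (Filter.Tendsto.const_mul_atTop he ?_)
      exact Filter.tendsto_atTop_add_const_left _ _ tendsto_natCast_atTop_atTop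
    refine squeeze_zero_norm (fun k => ?_) hden
    have hk : (0 : ℝ) ≤ k := k.cast_nonneg
    have ha : 0 < e * (x + k) + (t + 1) := by positivity
    have hm : 0 < x + N + k - 1 := by linarith
    have h1 : (x + N - 1) / (x + N + k - 1) ≤ 1 := by rw [div_le_one hm]; linarith
    have h2 : k / (x + N + k - 1) ≤ 1 := by rw [div_le_one hm]; linarith
    have h10 : 0 ≤ (x + N - 1) / (x + N + k - 1) := div_nonneg (by linarith) hm.le
    have h20 : 0 ≤ k / (x + N + k - 1) := by positivity
    have hTa : t + 1 ≤ e * (x + k) + (t + 1) := by nlinarith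
    have hTb : t + 1 ≤ e * (x + k + 1) + (t + 1) := by nlinarith
    have hb : 0 < e * (x + k + 1) + (t + 1) := by linarith
    have hSk : S k = -((x + N - 1) / (x + N + k - 1) * (e / (e * (x + k) + (t + 1))) *
          (e * (x + k) + (t + 1))⁻¹ +
        k / (x + N + k - 1) * (e / (e * (x + k + 1) + (t + 1))) *
          (e * (x + k) + (t + 1))⁻¹) := by
      rw [hS]
      have hbb : e * (x + k + 1) + (t + 1) = e * (x + k) + (t + 1) + e := by ring
      rw [hbb] at hb ⊢
      have hxx : x + N + k = (x + N + k - 1) + 1 := by ring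
      generalize e * (x + k) + (t + 1) = A at *
      generalize x + N + k - 1 = m at *
      rw [hxx]
      field_simp
      ring
    rw [hSk, norm_neg, Real.norm_of_nonneg (by positivity)]
    have h3 : (x + N - 1) / (x + N + k - 1) * (e / (e * (x + k) + (t + 1))) ≤
        1 * (e / (t + 1)) := by gcongr
    have h4 : k / (x + N + k - 1) * (e / (e * (x + k + 1) + (t + 1))) ≤
        1 * (e / (t + 1)) := by gcongr
    have h5 := inv_pos.2 ha
    nlinarith [mul_le_mul_of_nonneg_right h3 h5.le, mul_le_mul_of_nonneg_right h4 h5.le]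
  -- all terms are nonpositive, so the telescoping partial sums determine the series
  have hnn : ∀ k, 0 ≤ S (k + 1) - S k := fun k => by
    have hb := branch_den_pos hN k hx0
    have hu := u_mem hN k hx0
    have hu' := u_mem hN (k + 1) hx0
    have hint : 0 ≤ -∫ s in (u N (N + k) x)..(u N (N + k + 1) x), phi N e t s := by
      rw [← intervalIntegral.integral_neg]
      exact intervalIntegral.integral_nonneg (u_succ_le hN k hx0)
        fun s hs => (neg_pos.2 (phi_neg hN h ⟨hu.1.trans hs.1, hs.2.trans hu'.2⟩)).le
    have hphi := neg_pos.2 (phi_neg hN h hu)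
    have hk : (0 : ℝ) ≤ k := k.cast_nonneg
    have hc1 : 0 ≤ (((N + k : ℕ) : ℝ) + 1 - N) / (x + (N + k : ℕ)) ^ 2 :=
      div_nonneg (by push_cast; linarith) (by positivity)
    have hc2 : 0 ≤ N * (x + N - 1) / ((x + (N + k : ℕ) - 1) * (x + (N + k : ℕ)) ^ 3) :=
      div_nonneg (mul_nonneg N.cast_nonneg (by linarith)) (by positivity)
    linarith [hterm k, mul_nonneg hc1 hint, mul_nonneg hc2 hphi.le]
  have hsum : HasSum (fun k => S (k + 1) - S k) (e / (e * x + (t + 1)) ^ 2) := by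
    rw [hasSum_iff_tendsto_nat_of_nonneg hnn]
    simp_rw [Finset.sum_range_sub]
    simpa [hS0] using hlim.sub_const (S 0)
  unfold V
  rw [← hsum.tsum_eq, ← tsum_neg]
  exact tsum_congr fun k => by rw [hterm k]; ring

end Vphi

/-! ### The Perron-Frobenius operator -/

/-- The weight of the `k`-th inverse branch `u_{N, N + k}` in the Perron-Frobenius operator under
the invariant measure. -/
def weight (N k : ℕ) (x : ℝ) : ℝ := (x + N - 1) / ((x + N + k - 1) * (x + N + k))

/-- The sum of the weights with index at least `k`. -/
def weightTail (N k : ℕ) (x : ℝ) : ℝ := (x + N - 1) / (x + N + k - 1)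

/-- The Perron-Frobenius operator of the map under its invariant measure. -/
def transfer (N : ℕ) (f : ℝ → ℝ) (x : ℝ) : ℝ := ∑' k : ℕ, weight N k x * f (u N (N + k) x)

section Transfer

variable {N : ℕ}

theorem weight_den_pos (hN : 2 ≤ N) (k : ℕ) {x : ℝ} (hx : 0 ≤ x) :
    0 < x + N + k - 1 ∧ 0 < x + N - 1 := by
  have hn : (2 : ℝ) ≤ N := by exact_mod_cast hN
  have hk : (0 : ℝ) ≤ k := k.cast_nonneg
  constructor <;> linarith

theorem weight_pos (hN : 2 ≤ N) (k : ℕ) {x : ℝ} (hx : 0 ≤ x) : 0 < weight N k x := by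
  obtain ⟨h1, h2⟩ := weight_den_pos hN k hx
  exact div_pos h2 (mul_pos h1 (by linarith))

theorem weight_eq (hN : 2 ≤ N) (k : ℕ) {x : ℝ} (hx : 0 ≤ x) :
    weight N k x = weightTail N k x - weightTail N (k + 1) x := by
  obtain ⟨h1, h2⟩ := weight_den_pos hN k hx
  unfold weight weightTail
  push_cast
  have h3 : x + N + k ≠ 0 := by linarith
  have h4 : x + N + (k + 1) - 1 = x + N + k := by ring
  rw [h4]
  have h1' := h1.ne'
  field_simp
  ring

theorem weightTail_zero (hN : 2 ≤ N) {x : ℝ} (hx : 0 ≤ x) : weightTail N 0 x = 1 := by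
  have h := (weight_den_pos hN 0 hx).2.ne'
  simp [weightTail, h]

theorem weightTail_mono (hN : 2 ≤ N) (k : ℕ) {x y : ℝ} (hx : 0 ≤ x) (hxy : x ≤ y) :
    weightTail N k x ≤ weightTail N k y := by
  have h1 := (weight_den_pos hN k hx).1
  have hk : (0 : ℝ) ≤ k := k.cast_nonneg
  unfold weightTail
  rw [div_le_div_iff₀ h1 (by linarith)]
  nlinarith

theorem tendsto_weightTail (x : ℝ) :
    Filter.Tendsto (fun k => weightTail N k x) Filter.atTop (nhds 0) := by
  refine Filter.Tendsto.div_atTop tendsto_const_nhds ?_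
  exact Filter.tendsto_atTop_add_const_right _ _
    (Filter.tendsto_atTop_add_const_left _ _ tendsto_natCast_atTop_atTop)

theorem hasSum_weight (hN : 2 ≤ N) {x : ℝ} (hx : 0 ≤ x) : HasSum (fun k => weight N k x) 1 := by
  rw [hasSum_iff_tendsto_nat_of_nonneg fun k => (weight_pos hN k hx).le]
  simp_rw [weight_eq hN _ hx, Finset.sum_range_sub', weightTail_zero hN hx]
  simpa using (tendsto_weightTail x).const_sub 1

theorem exists_abs_le {f : ℝ → ℝ} (hf : ContinuousOn f (Icc 0 1)) :
    ∃ M, 0 ≤ M ∧ ∀ y ∈ Icc (0 : ℝ) 1, |f y| ≤ M := by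
  obtain ⟨M, hM⟩ := isCompact_Icc.exists_bound_of_continuousOn hf
  exact ⟨M, (norm_nonneg _).trans (hM 0 (by simp)), hM⟩

theorem hasSum_transfer (hN : 2 ≤ N) {f : ℝ → ℝ} (hf : ContinuousOn f (Icc 0 1)) {x : ℝ}
    (hx : 0 ≤ x) : HasSum (fun k => weight N k x * f (u N (N + k) x)) (transfer N f x) := by
  obtain ⟨M, -, hM⟩ := exists_abs_le hf
  refine Summable.hasSum (Summable.of_norm_bounded ((hasSum_weight hN hx).mul_right M).summable
    fun k => ?_)
  rw [norm_mul, Real.norm_of_nonneg (weight_pos hN k hx).le]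
  exact mul_le_mul_of_nonneg_left (hM _ (u_mem hN k hx)) (weight_pos hN k hx).le

theorem transfer_linear_comb (hN : 2 ≤ N) {f g : ℝ → ℝ} (hf : ContinuousOn f (Icc 0 1))
    (hg : ContinuousOn g (Icc 0 1)) (a b : ℝ) {x : ℝ} (hx : 0 ≤ x) :
    transfer N (fun y => a * f y + b * g y) x = a * transfer N f x + b * transfer N g x := by
  have h := ((hasSum_transfer hN hf hx).mul_left a).add ((hasSum_transfer hN hg hx).mul_left b)
  rw [← h.tsum_eq]
  exact tsum_congr fun k => by ring

theorem continuousOn_u (hN : 2 ≤ N) (k : ℕ) : ContinuousOn (u N (N + k)) (Icc 0 1) := by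
  unfold u
  refine continuousOn_const.sub (ContinuousOn.div (by fun_prop) (by fun_prop) fun x hx => ?_)
  have := branch_den_pos hN k hx.1
  linarith

theorem weight_le (hN : 2 ≤ N) (k : ℕ) {x : ℝ} (hx : x ∈ Icc (0 : ℝ) 1) :
    weight N k x ≤ N / (N - 1) * weight N k 0 := by
  obtain ⟨h1, h2⟩ := weight_den_pos hN k le_rfl
  have hx0 := hx.1
  have h3 : N / (N - 1) * weight N k 0 = N / ((0 + N + k - 1) * (0 + N + k)) := by
    unfold weight
    have : (N : ℝ) - 1 ≠ 0 := by linarith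
    rw [zero_add]
    field_simp
  rw [h3]
  unfold weight
  have h4 : (0 : ℝ) < 0 + N + k := by linarith
  gcongr
  all_goals linarith [hx.2]

theorem continuousOn_transfer (hN : 2 ≤ N) {f : ℝ → ℝ} (hf : ContinuousOn f (Icc 0 1)) :
    ContinuousOn (transfer N f) (Icc 0 1) := by
  obtain ⟨M, hM0, hM⟩ := exists_abs_le hf
  refine continuousOn_tsum (u := fun k => N / (N - 1) * weight N k 0 * M) (fun k => ?_)
    (((hasSum_weight hN le_rfl).mul_left _).mul_right M).summable fun k x hx => ?_
  · refine ContinuousOn.mul ?_ (hf.comp (continuousOn_u hN k) fun x hx => u_mem hN k hx.1)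
    unfold weight
    refine ContinuousOn.div (by fun_prop) (by fun_prop) fun x hx => ?_
    have h := (weight_den_pos hN k hx.1).1
    exact (mul_pos h (by linarith)).ne'
  · rw [norm_mul, Real.norm_of_nonneg (weight_pos hN k hx.1).le]
    exact mul_le_mul (weight_le hN k hx) (hM _ (u_mem hN k hx.1)) (abs_nonneg _)
      ((weight_pos hN k hx.1).le.trans (weight_le hN k hx))

theorem continuousOn_transfer_iterate (hN : 2 ≤ N) {f : ℝ → ℝ} (hf : ContinuousOn f (Icc 0 1))
    (n : ℕ) : ContinuousOn ((transfer N)^[n] f) (Icc 0 1) := by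
  induction n with
  | zero => exact hf
  | succ n ih =>
    rw [Function.iterate_succ_apply']
    exact continuousOn_transfer hN ih

/-- The operator preserves monotone functions: both `u_{N,i}(x)` and the weight tails increase
with `x`, and `u_{N,i}` increases with `i`. -/
theorem monotoneOn_transfer (hN : 2 ≤ N) {f : ℝ → ℝ} (hf : ContinuousOn f (Icc 0 1))
    (hm : MonotoneOn f (Icc 0 1)) : MonotoneOn (transfer N f) (Icc 0 1) := by
  intro x hx y hy hxy
  have hx0 := hx.1
  have hy0 := hy.1
  obtain ⟨M, -, hM⟩ := exists_abs_le hf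
  have hsum : HasSum (fun k => (weight N k y - weight N k x) * f (u N (N + k) y))
      (transfer N f y - ∑' k, weight N k x * f (u N (N + k) y)) := by
    have h1 : Summable fun k => weight N k x * f (u N (N + k) y) := by
      refine Summable.of_norm_bounded ((hasSum_weight hN hx0).mul_right M).summable fun k => ?_
      rw [norm_mul, Real.norm_of_nonneg (weight_pos hN k hx0).le]
      exact mul_le_mul_of_nonneg_left (hM _ (u_mem hN k hy0)) (weight_pos hN k hx0).le
    simpa only [sub_mul] using (hasSum_transfer hN hf hy0).sub h1.hasSum
  have h1 : transfer N f x ≤ ∑' k, weight N k x * f (u N (N + k) y) := by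
    refine Summable.tsum_le_tsum (fun k => ?_) (hasSum_transfer hN hf hx0).summable ?_
    · exact mul_le_mul_of_nonneg_left
        (hm (u_mem hN k hx0) (u_mem hN k hy0) (u_le_u hN k hx0 hxy)) (weight_pos hN k hx0).le
    · refine Summable.of_norm_bounded ((hasSum_weight hN hx0).mul_right M).summable fun k => ?_
      rw [norm_mul, Real.norm_of_nonneg (weight_pos hN k hx0).le]
      exact mul_le_mul_of_nonneg_left (hM _ (u_mem hN k hy0)) (weight_pos hN k hx0).le
  -- Abel summation, with the tail differences as coefficients of the increments of `f ∘ u`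
  have hpart : ∀ n, -(weightTail N n y - weightTail N n x) * f (u N (N + n) y) ≤
      ∑ k ∈ Finset.range n, (weight N k y - weight N k x) * f (u N (N + k) y) := by
    intro n
    induction n with
    | zero => simp [weightTail_zero hN hx0, weightTail_zero hN hy0]
    | succ n ih =>
      rw [Finset.sum_range_succ]
      have hmono := hm (u_mem hN n hy0) (u_mem hN (n + 1) hy0) (u_succ_le hN n hy0)
      have htail := weightTail_mono hN (n + 1) hx0 hxy
      rw [weight_eq hN n hx0, weight_eq hN n hy0]
      nlinarith [mul_le_mul_of_nonneg_left hmono (sub_nonneg.2 htail)]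
  have hlim : Filter.Tendsto
      (fun n => -(weightTail N n y - weightTail N n x) * f (u N (N + n) y))
      Filter.atTop (nhds 0) := by
    refine squeeze_zero_norm (a := fun n => |weightTail N n y - weightTail N n x| * M)
      (fun n => ?_) ?_
    · rw [norm_mul, norm_neg]
      exact mul_le_mul_of_nonneg_left (hM _ (u_mem hN n hy0)) (norm_nonneg _)
    · simpa using (((tendsto_weightTail y).sub (tendsto_weightTail x)).abs).mul_const M
  have := le_of_tendsto_of_tendsto' hlim hsum.tendsto_sum_nat hpart
  linarith

theorem monotoneOn_transfer_linear_comb (hN : 2 ≤ N) {f g : ℝ → ℝ} (hf : ContinuousOn f (Icc 0 1))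
    (hg : ContinuousOn g (Icc 0 1)) (a b : ℝ)
    (hm : MonotoneOn (fun y => a * f y + b * g y) (Icc 0 1)) :
    MonotoneOn (fun y => a * transfer N f y + b * transfer N g y) (Icc 0 1) := by
  refine (monotoneOn_transfer hN (by fun_prop) hm).congr fun x hx => ?_
  exact transfer_linear_comb hN hf hg a b hx.1

theorem continuousOn_gfun {e t : ℝ} (hN : 2 ≤ N) (he : 0 < e) (ht : 0 ≤ t) :
    ContinuousOn (gfun N e t) (Icc 0 1) :=
  fun _ hx => (hasDerivAt_gfun hN he ht hx).continuousAt.continuousWithinAt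

/-- The function `g` is chosen as a preimage of `h(x) = 1 / (e x + t + 1)`. -/
theorem transfer_gfun {e t : ℝ} (hN : 2 ≤ N) (he : 0 < e) (ht : 0 ≤ t) {x : ℝ} (hx : 0 ≤ x) :
    transfer N (gfun N e t) x = (e * x + (t + 1))⁻¹ := by
  have h := (hasSum_transfer hN (continuousOn_gfun hN he ht) hx).tendsto_sum_nat
  have hterm : ∀ k : ℕ, weight N k x * gfun N e t (u N (N + k) x) =
      weightTail N k x * (e * (x + k) + (t + 1))⁻¹ -
        weightTail N (k + 1) x * (e * (x + (k + 1 : ℕ)) + (t + 1))⁻¹ := by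
    intro k
    have hk : (0 : ℝ) ≤ k := k.cast_nonneg
    obtain ⟨h1, h2⟩ := weight_den_pos hN k hx
    rw [gfun_u hN he ht k hx]
    have ha : 0 < e * (x + k) + (t + 1) := by positivity
    have hb : 0 < e * (x + k + 1) + (t + 1) := by positivity
    unfold weight weightTail
    push_cast
    have h4 : x + N + (k + 1) - 1 = x + N + k := by ring
    have h5 : x + N + k ≠ 0 := by linarith
    have h1' := h1.ne'
    rw [h4, ← add_assoc x (k : ℝ) 1]
    field_simp
  simp_rw [hterm] at h
  rw [funext fun n => Finset.sum_range_sub'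
    (fun k : ℕ => weightTail N k x * (e * (x + k) + (t + 1))⁻¹) n] at h
  have hlim : Filter.Tendsto (fun k : ℕ => weightTail N k x * (e * (x + k) + (t + 1))⁻¹)
      Filter.atTop (nhds (0 * 0)) := by
    refine (tendsto_weightTail x).mul (tendsto_inv_atTop_zero.comp ?_)
    refine Filter.tendsto_atTop_add_const_right _ _ (Filter.Tendsto.const_mul_atTop he ?_)
    exact Filter.tendsto_atTop_add_const_left _ _ tendsto_natCast_atTop_atTop
  have := tendsto_nhds_unique h (hlim.const_sub _)
  simpa [weightTail_zero hN hx] using this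

end Transfer

/-! ### Distribution functions under the map -/

section Measures

variable {N : ℕ}

theorem measurable_renyiMap (N : ℕ) : Measurable (renyiMap N) := by
  unfold renyiMap
  refine Measurable.ite (measurableSet_singleton 1) measurable_const ?_
  have h : Measurable fun x : ℝ => (N : ℝ) / (1 - x) := by fun_prop
  exact h.sub (measurable_from_top.comp h.floor)

theorem renyiMap_mem (N : ℕ) (y : ℝ) : renyiMap N y ∈ Ico (0 : ℝ) 1 := by
  unfold renyiMap
  split_ifs
  · simp
  · rw [Int.self_sub_floor]
    exact ⟨Int.fract_nonneg _, Int.fract_lt_one _⟩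

theorem renyiMap_iterate_mem (N n : ℕ) {y : ℝ} (hy : y ∈ Icc (0 : ℝ) 1) :
    (renyiMap N)^[n] y ∈ Icc (0 : ℝ) 1 := by
  cases n with
  | zero => exact hy
  | succ n =>
    rw [Function.iterate_succ_apply']
    exact Ico_subset_Icc_self (renyiMap_mem N _)

theorem renyiMap_lt_iff (hN : 2 ≤ N) {x y : ℝ} (hx : x ∈ Icc (0 : ℝ) 1) (hy : y ∈ Icc (0 : ℝ) 1)
    (hy1 : y ≠ 1) : renyiMap N y < x ↔ ∃ k, y ∈ Ico (u N (N + k) 0) (u N (N + k) x) := by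
  have hn : (2 : ℝ) ≤ N := by exact_mod_cast hN
  have hd : 0 < 1 - y := sub_pos.2 (lt_of_le_of_ne hy.2 hy1)
  have hz : (N : ℝ) ≤ N / (1 - y) := by
    rw [le_div_iff₀ hd]
    nlinarith [hy.1]
  have hmem : ∀ k : ℕ, y ∈ Ico (u N (N + k) 0) (u N (N + k) x) ↔
      ((N + k : ℕ) : ℝ) ≤ N / (1 - y) ∧ (N : ℝ) / (1 - y) < x + (N + k : ℕ) := by
    intro k
    have h1 := branch_den_pos hN k hx.1
    have h2 := branch_den_pos hN k le_rfl
    have h3 : 1 - (N : ℝ) / (0 + (N + k : ℕ)) ≤ y ↔ ((N + k : ℕ) : ℝ) ≤ N / (1 - y) := by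
      rw [zero_add] at h2 ⊢
      rw [sub_le_comm, le_div_iff₀ (by linarith), le_div_iff₀ hd, mul_comm]
    have h4 : y < 1 - (N : ℝ) / (x + (N + k : ℕ)) ↔ (N : ℝ) / (1 - y) < x + (N + k : ℕ) := by
      rw [lt_sub_comm, div_lt_iff₀ (by linarith), div_lt_iff₀ hd, mul_comm]
    unfold u
    rw [mem_Ico, h3, h4]
  simp_rw [hmem]
  rw [renyiMap, if_neg hy1]
  constructor
  · intro h
    have hfl : N ≤ ⌊(N : ℝ) / (1 - y)⌋₊ := Nat.le_floor hz
    refine ⟨⌊(N : ℝ) / (1 - y)⌋₊ - N, ?_⟩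
    rw [Nat.add_sub_cancel' hfl, natCast_floor_eq_intCast_floor (by linarith)]
    exact ⟨Int.floor_le _, by linarith⟩
  · rintro ⟨k, h1, h2⟩
    have h3 : ⌊(N : ℝ) / (1 - y)⌋ = ((N + k : ℕ) : ℤ) := by
      rw [Int.floor_eq_iff]
      push_cast at h1 h2 ⊢
      exact ⟨h1, by linarith [hx.2]⟩
    rw [h3]
    push_cast at h2 ⊢
    linarith

theorem pairwise_disjoint_branch (hN : 2 ≤ N) {x : ℝ} (hx : x ∈ Icc (0 : ℝ) 1) :
    Pairwise (Function.onFun Disjoint fun k => Ico (u N (N + k) 0) (u N (N + k) x)) := by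
  have hstep : ∀ k, u N (N + k) x ≤ u N (N + (k + 1)) 0 := fun k => by
    refine (u_le_u hN k hx.1 hx.2).trans_eq ?_
    unfold u
    push_cast
    ring_nf
  have hmono : Monotone fun k => u N (N + k) 0 :=
    monotone_nat_of_le_succ fun k => u_succ_le hN k le_rfl
  refine (Std.Symm.pairwise_on (r := Disjoint) (fun k => Ico (u N (N + k) 0) (u N (N + k) x))).2 ?_
  intro k l hkl
  refine Set.disjoint_left.2 fun y hy hy' => ?_
  have : u N (N + (k + 1)) 0 ≤ u N (N + l) 0 := hmono hkl
  linarith [hy.2, hy'.1, hstep k]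

/-- The substitution `s = u_{N, N + k}(z)` turns the density `f(s) / (s + N - 1)` into one term of
the density of the image measure. -/
theorem integral_branch (hN : 2 ≤ N) {f : ℝ → ℝ} (hf : ContinuousOn f (Icc 0 1)) (k : ℕ) {x : ℝ}
    (hx : x ∈ Icc (0 : ℝ) 1) :
    ∫ s in (u N (N + k) 0)..(u N (N + k) x), f s / (s + N - 1) =
      ∫ z in (0 : ℝ)..x, weight N k z * f (u N (N + k) z) / (z + N - 1) := by
  have hn : (2 : ℝ) ≤ N := by exact_mod_cast hN
  have hsub : uIcc 0 x ⊆ Icc 0 1 := uIcc_subset_Icc (by simp) hx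
  have hden : ∀ z ∈ Icc (0 : ℝ) 1, z + (N + k : ℕ) ≠ 0 := fun z hz => by
    have := branch_den_pos hN k hz.1
    linarith
  rw [← intervalIntegral.integral_comp_mul_deriv'' (f := u N (N + k))
    (f' := fun z => N / (z + (N + k : ℕ)) ^ 2) (g := fun s => f s / (s + N - 1))]
  · refine intervalIntegral.integral_congr fun z hz => ?_
    have hz0 := (hsub hz).1
    obtain ⟨h1, h2⟩ := weight_den_pos hN k hz0
    have h3 : 0 < z + N + k := by linarith
    have hu : u N (N + k) z + N - 1 = N * (z + N + k - 1) / (z + N + k) := by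
      unfold u
      push_cast
      rw [← add_assoc]
      field_simp
      ring
    simp only [Function.comp]
    rw [hu]
    unfold weight
    push_cast
    rw [← add_assoc]
    have h1' := h1.ne'
    have h2' := h2.ne'
    field_simp
  · exact (continuousOn_u hN k).mono hsub
  · intro z hz
    rw [min_eq_left hx.1, max_eq_right hx.1] at hz
    have hz' : z ∈ Icc (0 : ℝ) 1 := ⟨hz.1.le, hz.2.le.trans hx.2⟩
    have h := ((hasDerivAt_const z (N : ℝ)).div ((hasDerivAt_id z).add_const ((N + k : ℕ) : ℝ))
      (hden z hz')).const_sub 1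
    exact (h.congr_deriv (by simp [neg_div])).hasDerivWithinAt
  · exact ContinuousOn.div (by fun_prop) (by fun_prop)
      fun z hz => pow_ne_zero 2 (hden z (hsub hz))
  · have himg : u N (N + k) '' uIcc 0 x ⊆ Icc 0 1 := by
      rintro _ ⟨z, hz, rfl⟩
      exact u_mem hN k (hsub hz).1
    refine ContinuousOn.div (hf.mono himg) (by fun_prop) fun s hs => ?_
    linarith [(himg hs).1]

theorem hasSum_integral_branch (hN : 2 ≤ N) {f : ℝ → ℝ} (hf : ContinuousOn f (Icc 0 1)) {x : ℝ}
    (hx : x ∈ Icc (0 : ℝ) 1) :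
    HasSum (fun k => ∫ s in (u N (N + k) 0)..(u N (N + k) x), f s / (s + N - 1))
      (∫ z in (0 : ℝ)..x, transfer N f z / (z + N - 1)) := by
  have hn : (2 : ℝ) ≤ N := by exact_mod_cast hN
  obtain ⟨M, hM0, hM⟩ := exists_abs_le hf
  have hsub : uIoc 0 x ⊆ Icc 0 1 := uIoc_subset_uIcc.trans (uIcc_subset_Icc (by simp) hx)
  simp_rw [fun k => integral_branch hN hf k hx]
  refine intervalIntegral.hasSum_integral_of_dominated_convergence
    (fun k _ => N / (N - 1) * weight N k 0 * M) (fun k => ?_) (fun k => ?_) ?_ ?_ ?_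
  · refine ContinuousOn.aestronglyMeasurable (ContinuousOn.mono ?_ hsub) measurableSet_uIoc
    refine ContinuousOn.div (ContinuousOn.mul ?_
      (hf.comp (continuousOn_u hN k) fun z hz => u_mem hN k hz.1)) (by fun_prop) fun z hz => ?_
    · unfold weight
      refine ContinuousOn.div (by fun_prop) (by fun_prop) fun z hz => ?_
      have h := (weight_den_pos hN k hz.1).1
      exact (mul_pos h (by linarith)).ne'
    · exact (weight_den_pos hN k hz.1).2.ne'
  · refine Filter.Eventually.of_forall fun z hz => ?_
    have hz := hsub hz
    have hw := (weight_pos hN k hz.1).le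
    rw [norm_div, norm_mul, Real.norm_of_nonneg hw]
    refine (div_le_self (by positivity) ?_).trans ?_
    · rw [Real.norm_of_nonneg (weight_den_pos hN k hz.1).2.le]
      linarith [hz.1]
    · exact mul_le_mul (weight_le hN k hz) (hM _ (u_mem hN k hz.1)) (abs_nonneg _)
        (hw.trans (weight_le hN k hz))
  · exact Filter.Eventually.of_forall fun z _ =>
      (((hasSum_weight hN le_rfl).mul_left _).mul_right M).summable
  · exact intervalIntegrable_const
  · exact Filter.Eventually.of_forall fun z hz =>
      (hasSum_transfer hN hf (hsub hz).1).div_const _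

theorem intervalIntegrable_density (hN : 2 ≤ N) {f : ℝ → ℝ} (hf : ContinuousOn f (Icc 0 1))
    {a b : ℝ} (ha : a ∈ Icc (0 : ℝ) 1) (hb : b ∈ Icc (0 : ℝ) 1) :
    IntervalIntegrable (fun y => f y / (y + N - 1)) volume a b := by
  have hsub : uIcc a b ⊆ Icc 0 1 := uIcc_subset_Icc ha hb
  refine ContinuousOn.intervalIntegrable (ContinuousOn.mono ?_ hsub)
  exact ContinuousOn.div hf (by fun_prop) fun z hz => (weight_den_pos hN 0 hz.1).2.ne'

/-- If a measure on `[0, 1)` has the density `f(y) / (y + N - 1)`, then its image under the map has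
the density `U f(y) / (y + N - 1)`, where `U` is the operator `transfer`. -/
theorem measureReal_map_renyiMap (hN : 2 ≤ N) {ν : Measure ℝ} [IsFiniteMeasure ν]
    (hν : ∀ᵐ y ∂ν, y ∈ Ico (0 : ℝ) 1) {f : ℝ → ℝ} (hf : ContinuousOn f (Icc 0 1))
    (hF : ∀ x ∈ Icc (0 : ℝ) 1, ν.real (Ico 0 x) = ∫ y in (0 : ℝ)..x, f y / (y + N - 1))
    {x : ℝ} (hx : x ∈ Icc (0 : ℝ) 1) :
    (ν.map (renyiMap N)).real (Ico 0 x) =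
      ∫ y in (0 : ℝ)..x, transfer N f y / (y + N - 1) := by
  have hpre : renyiMap N ⁻¹' Ico 0 x =ᵐ[ν] ⋃ k, Ico (u N (N + k) 0) (u N (N + k) x) := by
    filter_upwards [hν] with y hy
    apply propext
    change renyiMap N y ∈ Ico 0 x ↔ y ∈ ⋃ k, Ico (u N (N + k) 0) (u N (N + k) x)
    rw [mem_iUnion, ← renyiMap_lt_iff hN hx (Ico_subset_Icc_self hy) hy.2.ne, mem_Ico]
    exact and_iff_right (renyiMap_mem N y).1
  have hpiece : ∀ k, ν.real (Ico (u N (N + k) 0) (u N (N + k) x)) =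
      ∫ s in (u N (N + k) 0)..(u N (N + k) x), f s / (s + N - 1) := by
    intro k
    have ha := u_mem hN k (le_refl (0 : ℝ))
    have hb := u_mem hN k hx.1
    have hab := u_le_u hN k le_rfl hx.1
    have h0 : (0 : ℝ) ∈ Icc (0 : ℝ) 1 := by simp
    rw [← intervalIntegral.integral_interval_sub_left
      (intervalIntegrable_density hN hf h0 hb) (intervalIntegrable_density hN hf h0 ha),
      ← hF _ ha, ← hF _ hb, ← measureReal_sdiff (Ico_subset_Ico_right hab) measurableSet_Ico]
    congr 1
    ext y
    simp only [mem_Ico, mem_sdiff, not_and, not_lt]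
    exact ⟨fun h => ⟨⟨ha.1.trans h.1, h.2⟩, fun _ => h.1⟩, fun h => ⟨h.2 h.1.1, h.1.2⟩⟩
  have hsum : HasSum (fun k => ν.real (Ico (u N (N + k) 0) (u N (N + k) x)))
      (ν.real (⋃ k, Ico (u N (N + k) 0) (u N (N + k) x))) := by
    have h1 := measure_iUnion (μ := ν) (pairwise_disjoint_branch hN hx) fun _ => measurableSet_Ico
    have h2 := ENNReal.hasSum_toReal (h1 ▸ measure_ne_top ν _)
    rw [← ENNReal.tsum_toReal_eq fun _ => measure_ne_top ν _, ← h1] at h2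
    exact h2
  simp_rw [hpiece] at hsum
  rw [map_measureReal_apply (measurable_renyiMap N) measurableSet_Ico, measureReal_congr hpre]
  exact hsum.unique (hasSum_integral_branch hN hf hx)

theorem measureReal_map_renyiMap_iterate (hN : 2 ≤ N) {ν : Measure ℝ} [IsFiniteMeasure ν]
    (hν : ∀ᵐ y ∂ν, y ∈ Ico (0 : ℝ) 1) {f : ℝ → ℝ} (hf : ContinuousOn f (Icc 0 1))
    (hF : ∀ x ∈ Icc (0 : ℝ) 1, ν.real (Ico 0 x) = ∫ y in (0 : ℝ)..x, f y / (y + N - 1))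
    (n : ℕ) : ∀ x ∈ Icc (0 : ℝ) 1, (ν.map (renyiMap N)^[n]).real (Ico 0 x) =
      ∫ y in (0 : ℝ)..x, (transfer N)^[n] f y / (y + N - 1) := by
  induction n with
  | zero => simpa using hF
  | succ n ih =>
    intro x hx
    have hmeas := (measurable_renyiMap N).iterate n
    rw [Function.iterate_succ', Function.iterate_succ_apply',
      ← Measure.map_map (measurable_renyiMap N) hmeas]
    have hae : ∀ᵐ y ∂(ν.map (renyiMap N)^[n]), y ∈ Ico (0 : ℝ) 1 := by
      refine (ae_map_iff hmeas.aemeasurable measurableSet_Ico).2 ?_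
      cases n with
      | zero => simpa using hν
      | succ m =>
        refine Filter.Eventually.of_forall fun y => ?_
        rw [Function.iterate_succ_apply']
        exact renyiMap_mem N _
    exact measureReal_map_renyiMap hN hae (continuousOn_transfer_iterate hN hf n) ih hx

/-- The distribution function of the `n`-th iterate under a measure with a continuous density. -/
theorem measureReal_iterate_lt (hN : 2 ≤ N) {μ : Measure ℝ} [IsProbabilityMeasure μ]
    (hμ : μ (Icc 0 1) = 1) (hac : μ ≪ volume) {f : ℝ → ℝ} (hf : ContinuousOn f (Icc 0 1))
    (hfd : ∀ᵐ x ∂(volume.restrict (Icc (0 : ℝ) 1)),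
      f x = (x + N - 1) * (μ.rnDeriv volume x).toReal) (n : ℕ) {x : ℝ} (hx : x ∈ Icc (0 : ℝ) 1) :
    μ.real {y ∈ Icc (0 : ℝ) 1 | (renyiMap N)^[n] y < x} =
      ∫ y in (0 : ℝ)..x, (transfer N)^[n] f y / (y + N - 1) := by
  have hmem : ∀ᵐ y ∂μ, y ∈ Icc (0 : ℝ) 1 := (prob_compl_eq_zero_iff measurableSet_Icc).2 hμ
  have hne : ∀ᵐ y ∂μ, y ≠ 1 := hac.ae_le (Measure.ae_ne volume 1)
  have hν : ∀ᵐ y ∂μ, y ∈ Ico (0 : ℝ) 1 := by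
    filter_upwards [hmem, hne] with y h1 h2
    exact ⟨h1.1, lt_of_le_of_ne h1.2 h2⟩
  have hF : ∀ x ∈ Icc (0 : ℝ) 1, μ.real (Ico 0 x) = ∫ y in (0 : ℝ)..x, f y / (y + N - 1) := by
    intro x hx
    rw [intervalIntegral.integral_of_le hx.1, ← integral_Ico_eq_integral_Ioc,
      ← Measure.setIntegral_toReal_rnDeriv hac]
    refine setIntegral_congr_ae measurableSet_Ico ?_
    rw [ae_restrict_iff' measurableSet_Icc] at hfd
    filter_upwards [hfd] with y h hy
    rw [h ⟨hy.1, hy.2.le.trans hx.2⟩, mul_div_cancel_left₀]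
    exact (weight_den_pos hN 0 hy.1).2.ne'
  rw [← measureReal_map_renyiMap_iterate hN hν hf hF n x hx,
    map_measureReal_apply ((measurable_renyiMap N).iterate n) measurableSet_Ico]
  refine measureReal_congr ?_
  filter_upwards [hmem] with y hy
  apply propext
  change (y ∈ Icc (0 : ℝ) 1 ∧ (renyiMap N)^[n] y < x) ↔ (renyiMap N)^[n] y ∈ Ico 0 x
  rw [mem_Ico, and_iff_right hy, and_iff_right (renyiMap_iterate_mem N n hy).1]

theorem measureReal_iterate_lt_one {μ : Measure ℝ} [IsProbabilityMeasure μ]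
    (hμ : μ (Icc 0 1) = 1) {n : ℕ} (hn : 1 ≤ n) :
    μ.real {y ∈ Icc (0 : ℝ) 1 | (renyiMap N)^[n] y < 1} = 1 := by
  have : {y ∈ Icc (0 : ℝ) 1 | (renyiMap N)^[n] y < 1} = Icc 0 1 := by
    refine Set.sep_eq_self_iff_mem_true.2 fun y _ => ?_
    obtain ⟨m, rfl⟩ := Nat.exists_eq_add_of_le' hn
    rw [Function.iterate_succ_apply']
    exact (renyiMap_mem N _).2
  rw [this, measureReal_def, hμ, ENNReal.toReal_one]

end Measures

/-! ### Monotone densities -/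

section LogDensity

variable {N : ℕ}

/-- The distribution function `G_N` without its normalisation; its derivative is
`1 / (x + N - 1)`. -/
def logDist (N : ℕ) (x : ℝ) : ℝ := Real.log ((x + N - 1) / (N - 1))

theorem hasDerivAt_logDist (hN : 2 ≤ N) {x : ℝ} (hx : 0 ≤ x) :
    HasDerivAt (logDist N) (1 / (x + N - 1)) x := by
  have h := (weight_den_pos hN 0 hx).2
  have h0 := (weight_den_pos hN 0 (le_refl (0 : ℝ))).2
  have h1 : (N : ℝ) - 1 ≠ 0 := by linarith
  have h2 : HasDerivAt (fun x : ℝ => (x + N - 1) / ((N : ℝ) - 1)) (1 / ((N : ℝ) - 1)) x :=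
    (((hasDerivAt_id x).add_const (N : ℝ)).sub_const 1).div_const _
  refine (h2.log (div_ne_zero h.ne' h1)).congr_deriv ?_
  have := h.ne'
  field_simp

theorem logDist_zero (hN : 2 ≤ N) : logDist N 0 = 0 := by
  have h := (weight_den_pos hN 0 (le_refl (0 : ℝ))).2
  have h1 : (N : ℝ) - 1 ≠ 0 := by linarith
  simp [logDist, h1]

theorem logDist_one : logDist N 1 = Real.log (N / (N - 1)) := by
  unfold logDist
  rw [add_sub_cancel_left]

theorem logDist_mono (hN : 2 ≤ N) {x y : ℝ} (hx : 0 ≤ x) (hxy : x ≤ y) :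
    logDist N x ≤ logDist N y := by
  have h := (weight_den_pos hN 0 hx).2
  have h0 := (weight_den_pos hN 0 (le_refl (0 : ℝ))).2
  have h1 : 0 < (N : ℝ) - 1 := by linarith
  unfold logDist
  gcongr

theorem log_ratio_pos (hN : 2 ≤ N) : 0 < Real.log (N / (N - 1)) := by
  have hn : (2 : ℝ) ≤ N := by exact_mod_cast hN
  refine Real.log_pos ?_
  rw [one_lt_div (by linarith)]
  linarith

theorem G_eq (N : ℕ) (x : ℝ) : G N x = logDist N x / Real.log (N / (N - 1)) := rfl

theorem G_mem (hN : 2 ≤ N) {x : ℝ} (hx : x ∈ Icc (0 : ℝ) 1) : G N x ∈ Icc (0 : ℝ) 1 := by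
  have hL := log_ratio_pos hN
  rw [G_eq]
  constructor
  · exact div_nonneg ((logDist_zero hN).symm.le.trans (logDist_mono hN le_rfl hx.1)) hL.le
  · rw [div_le_one hL, ← logDist_one]
    exact logDist_mono hN hx.1 hx.2

theorem continuousOn_logDist (hN : 2 ≤ N) : ContinuousOn (logDist N) (Icc 0 1) :=
  fun _ hx => (hasDerivAt_logDist hN hx.1).continuousAt.continuousWithinAt

theorem integral_density_const (hN : 2 ≤ N) (c : ℝ) {a b : ℝ} (ha : a ∈ Icc (0 : ℝ) 1)
    (hb : b ∈ Icc (0 : ℝ) 1) :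
    ∫ y in a..b, c / (y + N - 1) = c * (logDist N b - logDist N a) := by
  have hsub : uIcc a b ⊆ Icc 0 1 := uIcc_subset_Icc ha hb
  rw [mul_sub]
  refine intervalIntegral.integral_eq_sub_of_hasDerivAt (f := fun y => c * logDist N y)
    (fun y hy => ?_) (intervalIntegrable_density hN continuousOn_const ha hb)
  exact ((hasDerivAt_logDist hN (hsub hy).1).const_mul c).congr_deriv (mul_one_div _ _)

theorem integral_density_logDist (hN : 2 ≤ N) {x : ℝ} (hx : x ∈ Icc (0 : ℝ) 1) :
    ∫ y in (0 : ℝ)..x, logDist N y / (y + N - 1) = logDist N x ^ 2 / 2 := by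
  have h0 : (0 : ℝ) ∈ Icc (0 : ℝ) 1 := by simp
  have hsub : uIcc 0 x ⊆ Icc 0 1 := uIcc_subset_Icc h0 hx
  rw [intervalIntegral.integral_eq_sub_of_hasDerivAt (f := fun y => logDist N y ^ 2 / 2)
    (fun y hy => ?_) (intervalIntegrable_density hN (continuousOn_logDist hN) h0 hx)]
  · simp [logDist_zero hN]
  · refine (((hasDerivAt_logDist hN (hsub hy).1).pow 2).div_const 2).congr_deriv ?_
    norm_num
    ring

/-- The mean of a monotone function over `[0, x]` is at most its mean over `[0, 1]`. -/
theorem integral_density_le_of_monotoneOn (hN : 2 ≤ N) {p : ℝ → ℝ}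
    (hp : ContinuousOn p (Icc 0 1)) (hm : MonotoneOn p (Icc 0 1)) {x : ℝ}
    (hx : x ∈ Icc (0 : ℝ) 1) :
    ∫ y in (0 : ℝ)..x, p y / (y + N - 1) ≤ G N x * ∫ y in (0 : ℝ)..1, p y / (y + N - 1) := by
  have h0 : (0 : ℝ) ∈ Icc (0 : ℝ) 1 := by simp
  have h1 : (1 : ℝ) ∈ Icc (0 : ℝ) 1 := by simp
  have hL := log_ratio_pos hN
  have hG := G_mem hN hx
  have hl : logDist N x = Real.log (N / (N - 1)) * G N x := by
    rw [G_eq, mul_div_cancel₀ _ hL.ne']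
  have hA : ∫ y in (0 : ℝ)..x, p y / (y + N - 1) ≤ ∫ y in (0 : ℝ)..x, p x / (y + N - 1) := by
    refine intervalIntegral.integral_mono_on hx.1 (intervalIntegrable_density hN hp h0 hx)
      (intervalIntegrable_density hN continuousOn_const h0 hx) fun y hy => ?_
    have := (weight_den_pos hN 0 hy.1).2
    gcongr
    exact hm ⟨hy.1, hy.2.trans hx.2⟩ hx hy.2
  have hB : ∫ y in x..1, p x / (y + N - 1) ≤ ∫ y in x..1, p y / (y + N - 1) := by
    refine intervalIntegral.integral_mono_on hx.2
      (intervalIntegrable_density hN continuousOn_const hx h1)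
      (intervalIntegrable_density hN hp hx h1) fun y hy => ?_
    have := (weight_den_pos hN 0 (hx.1.trans hy.1)).2
    gcongr
    exact hm hx ⟨hx.1.trans hy.1, hy.2⟩ hy.1
  rw [integral_density_const hN _ h0 hx, logDist_zero hN, hl] at hA
  rw [integral_density_const hN _ hx h1, logDist_one, hl] at hB
  rw [← intervalIntegral.integral_add_adjacent_intervals (intervalIntegrable_density hN hp h0 hx)
    (intervalIntegrable_density hN hp hx h1)]
  nlinarith [mul_le_mul_of_nonneg_left hA (sub_nonneg.2 hG.2), mul_le_mul_of_nonneg_left hB hG.1]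

/-- In the variable `s = G_N(x)`, monotonicity of `a q + b log` bounds the second derivative of the
distribution function with density `q` from one side, whence its deviation from `s` is compared
with the corresponding multiple of `s (1 - s)`. -/
theorem deviation_le_of_monotoneOn (hN : 2 ≤ N) {q : ℝ → ℝ} (hq : ContinuousOn q (Icc 0 1))
    (h1 : ∫ y in (0 : ℝ)..1, q y / (y + N - 1) = 1) (a b : ℝ)
    (hm : MonotoneOn (fun y => a * q y + b * logDist N y) (Icc 0 1)) {x : ℝ}
    (hx : x ∈ Icc (0 : ℝ) 1) :
    a * ((∫ y in (0 : ℝ)..x, q y / (y + N - 1)) - G N x) ≤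
      b / 2 * Real.log (N / (N - 1)) ^ 2 * (G N x * (1 - G N x)) := by
  have h0 : (0 : ℝ) ∈ Icc (0 : ℝ) 1 := by simp
  have hl' := continuousOn_logDist hN
  have hL := log_ratio_pos hN
  have hl : logDist N x = Real.log (N / (N - 1)) * G N x := by
    rw [G_eq, mul_div_cancel₀ _ hL.ne']
  have hsplit : ∀ x ∈ Icc (0 : ℝ) 1,
      ∫ y in (0 : ℝ)..x, (a * q y + b * logDist N y) / (y + N - 1) =
        a * (∫ y in (0 : ℝ)..x, q y / (y + N - 1)) + b * (logDist N x ^ 2 / 2) := by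
    intro x hx
    rw [← integral_density_logDist hN hx, ← intervalIntegral.integral_const_mul,
      ← intervalIntegral.integral_const_mul, ← intervalIntegral.integral_add
        ((intervalIntegrable_density hN hq h0 hx).const_mul a)
        ((intervalIntegrable_density hN hl' h0 hx).const_mul b)]
    simp_rw [add_div, mul_div_assoc]
  have h := integral_density_le_of_monotoneOn hN (by fun_prop) hm hx
  rw [hsplit x hx, hsplit 1 (by simp), h1, logDist_one, hl] at h
  linarith

theorem monotoneOn_Icc_of_hasDerivWithinAt {p p' : ℝ → ℝ}
    (hp : ∀ x ∈ Icc (0 : ℝ) 1, HasDerivWithinAt p (p' x) (Icc 0 1) x)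
    (h0 : ∀ x ∈ Icc (0 : ℝ) 1, 0 ≤ p' x) : MonotoneOn p (Icc 0 1) :=
  monotoneOn_of_hasDerivWithinAt_nonneg (convex_Icc 0 1) (fun x hx => (hp x hx).continuousWithinAt)
    (fun x hx => (hp x (interior_subset hx)).mono interior_subset)
    fun x hx => h0 x (interior_subset hx)

end LogDensity

/-! ### Extrema over the unit interval -/

theorem exists_maxI {f : ℝ → ℝ} (hf : ContinuousOn f (Icc 0 1)) :
    ∃ x ∈ Icc (0 : ℝ) 1, maxI f = f x ∧ ∀ y ∈ Icc (0 : ℝ) 1, f y ≤ maxI f := by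
  obtain ⟨x, hx, h1, h2⟩ := isCompact_Icc.exists_sSup_image_eq_and_ge (by simp) hf
  exact ⟨x, hx, h1, fun y hy => (h2 y hy).trans_eq h1.symm⟩

theorem exists_minI {f : ℝ → ℝ} (hf : ContinuousOn f (Icc 0 1)) :
    ∃ x ∈ Icc (0 : ℝ) 1, minI f = f x ∧ ∀ y ∈ Icc (0 : ℝ) 1, minI f ≤ f y := by
  obtain ⟨x, hx, h1, h2⟩ := isCompact_Icc.exists_sInf_image_eq_and_le (by simp) hf
  exact ⟨x, hx, h1, fun y hy => h1.trans_le (h2 y hy)⟩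

/-! ### The constants `v_N` and `w_N` -/

section Constants

variable {N : ℕ} {e t : ℝ}

theorem v_eq (h : Admissible N e t) : v N e t = N / (2 * (1 + (t + 1) / e) ^ 2) := by
  have he := h.e_pos
  unfold v
  have : 0 < e + t + 1 := by linarith [h.t_mem.1]
  have h2 : 1 + (t + 1) / e = (e + t + 1) / e := by field_simp; ring
  rw [h2]
  field_simp

theorem v_pos (hN : 2 ≤ N) (h : Admissible N e t) : 0 < v N e t := by
  have hn : (2 : ℝ) ≤ N := by exact_mod_cast hN
  have he := h.e_pos
  have : 0 < e + t + 1 := by linarith [h.t_mem.1]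
  unfold v
  positivity

theorem inv_v (h : Admissible N e t) :
    (v N e t)⁻¹ = 2 * (1 + (t + 1) / e) ^ 2 / N := by
  rw [v_eq h, inv_div]

theorem phi_div_V_phi (hN : 2 ≤ N) (h : Admissible N e t) {x : ℝ} (hx : x ∈ Icc (0 : ℝ) 1) :
    phi N e t x / V N (phi N e t) x = -quot N ((t + 1) / e) x := by
  have he := h.e_pos
  have hT : 0 < e * x + (t + 1) := by nlinarith [hx.1, h.t_mem.1]
  rw [V_phi hN h hx, div_eq_iff (by positivity)]
  linarith [neg_phi_eq_quot hN he h.t_mem.1 hx]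

/-- The number `w_N` is the reciprocal of the least value of `-φ / Vφ`. -/
theorem exists_w_eq (hN : 2 ≤ N) (h : Admissible N e t) :
    ∃ x ∈ Icc (0 : ℝ) 1, w N e t = (quot N ((t + 1) / e) x)⁻¹ ∧
      ∀ y ∈ Icc (0 : ℝ) 1, quot N ((t + 1) / e) x ≤ quot N ((t + 1) / e) y := by
  have he := h.e_pos
  have hcont : ContinuousOn (fun x => phi N e t x / V N (phi N e t) x) (Icc 0 1) := by
    refine ((continuousOn_phi hN he h.t_mem.1).div (g := fun x => e / (e * x + (t + 1)) ^ 2)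
      ?_ fun x hx => ?_).congr fun x hx => by simp only [V_phi hN h hx, Pi.div_apply]
    · refine ContinuousOn.div (by fun_prop) (by fun_prop) fun x hx => ?_
      have hT : 0 < e * x + (t + 1) := by nlinarith [hx.1, h.t_mem.1]
      positivity
    · have hT : 0 < e * x + (t + 1) := by nlinarith [hx.1, h.t_mem.1]
      positivity
  obtain ⟨x, hx, h1, h2⟩ := exists_maxI hcont
  refine ⟨x, hx, ?_, fun y hy => ?_⟩
  · rw [w, h1, phi_div_V_phi hN h hx, neg_div_neg_eq, one_div]
  · have := h2 y hy
    rw [h1, phi_div_V_phi hN h hx, phi_div_V_phi hN h hy] at this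
    linarith

theorem v_lt_w_lt_one (hN : 2 ≤ N) (h : Admissible N e t) :
    v N e t < w N e t ∧ w N e t < 1 := by
  have hn : (2 : ℝ) ≤ N := by exact_mod_cast hN
  have hy : 0 < (t + 1) / e := div_pos (by linarith [h.t_mem.1]) h.e_pos
  obtain ⟨x, hx, hw, hmin⟩ := exists_w_eq hN h
  have h1 := one_lt_quot hn hy h.ratio_root hx
  rw [hw]
  constructor
  · rw [← inv_inv (v N e t), inv_v h]
    refine inv_strictAnti₀ (by linarith) ?_
    exact (hmin (1 / 2) (by norm_num)).trans_lt (quot_lt hn hy h.ratio_root (by norm_num))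
  · exact inv_lt_one_of_one_lt₀ h1

theorem v_mul_neg_phi_le (hN : 2 ≤ N) (h : Admissible N e t) {x : ℝ} (hx : x ∈ Icc (0 : ℝ) 1) :
    v N e t * -phi N e t x ≤ e / (e * x + (t + 1)) ^ 2 := by
  have hn : (2 : ℝ) ≤ N := by exact_mod_cast hN
  have he := h.e_pos
  have hy : 0 < (t + 1) / e := div_pos (by linarith [h.t_mem.1]) he
  have hT : 0 < e * x + (t + 1) := by nlinarith [hx.1, h.t_mem.1]
  rw [neg_phi_eq_quot hN he h.t_mem.1 hx, ← mul_assoc]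
  refine mul_le_of_le_one_left (by positivity) ?_
  rw [← le_inv_mul_iff₀ (v_pos hN h), mul_one, inv_v h]
  exact quot_le hn hy h.ratio_root hx

theorem v_mul_neg_phi_one (hN : 2 ≤ N) (h : Admissible N e t) :
    v N e t * -phi N e t 1 = e / (e + (t + 1)) ^ 2 := by
  have hn : (2 : ℝ) ≤ N := by exact_mod_cast hN
  rw [neg_phi_eq_quot hN h.e_pos h.t_mem.1 (by simp), quot_one hn, ← inv_v h, ← mul_assoc,
    mul_inv_cancel₀ (v_pos hN h).ne', one_mul, mul_one]

theorem le_w_mul_neg_phi (hN : 2 ≤ N) (h : Admissible N e t) {x : ℝ} (hx : x ∈ Icc (0 : ℝ) 1) :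
    e / (e * x + (t + 1)) ^ 2 ≤ w N e t * -phi N e t x := by
  have hn : (2 : ℝ) ≤ N := by exact_mod_cast hN
  have he := h.e_pos
  have hy : 0 < (t + 1) / e := div_pos (by linarith [h.t_mem.1]) he
  have hT : 0 < e * x + (t + 1) := by nlinarith [hx.1, h.t_mem.1]
  obtain ⟨z, hz, hw, hmin⟩ := exists_w_eq hN h
  have h1 := one_lt_quot hn hy h.ratio_root hz
  rw [neg_phi_eq_quot hN he h.t_mem.1 hx, ← mul_assoc, hw]
  refine le_mul_of_one_le_left (by positivity) ?_
  rw [inv_mul_eq_div, one_le_div (by linarith)]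
  exact hmin x hx

/-- The function `(x + N - 1) Vφ(x)` is least at `x = 1`. -/
theorem density_mul_V_phi_ge (hN : 2 ≤ N) (h : Admissible N e t) {x : ℝ}
    (hx : x ∈ Icc (0 : ℝ) 1) :
    N * (e / (e + (t + 1)) ^ 2) ≤ (x + N - 1) * (e / (e * x + (t + 1)) ^ 2) := by
  have hn : (2 : ℝ) ≤ N := by exact_mod_cast hN
  have he := h.e_pos
  have hT : 0 < t + 1 := by linarith [h.t_mem.1]
  have hx0 := hx.1
  have hlt := ratio_lt hn h.ratio_root
  rw [div_lt_iff₀ he] at hlt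
  have hq : 0 ≤ (N - 1) * (e + (t + 1)) ^ 2 - N * (t + 1) ^ 2 := by
    have h1 : 0 ≤ ((N - 1) * e - (t + 1)) * (t + 1) := mul_nonneg (by linarith) hT.le
    have h2 : 0 ≤ (N - 1 : ℝ) * (e * (t + 1)) := mul_nonneg (by linarith) (by positivity)
    have h3 : 0 ≤ (N - 1 : ℝ) * e ^ 2 := mul_nonneg (by linarith) (by positivity)
    nlinarith
  rw [← mul_div_assoc, ← mul_div_assoc, div_le_div_iff₀ (by positivity) (by positivity)]
  have h4 := mul_nonneg (sub_nonneg.2 hx.2) (add_nonneg hq (show 0 ≤ N * e ^ 2 * x by positivity))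
  have h5 := mul_nonneg he.le h4
  linarith

end Constants

/-! ### Iterates of the operator -/

section Iterates

variable {N : ℕ} {e t : ℝ}

theorem hasDerivAt_h (he : 0 < e) (ht : 0 ≤ t) {x : ℝ} (hx : 0 ≤ x) :
    HasDerivAt (fun x : ℝ => (e * x + (t + 1))⁻¹) (-(e / (e * x + (t + 1)) ^ 2)) x := by
  have hT : 0 < e * x + (t + 1) := by positivity
  have h1 : HasDerivAt (fun x : ℝ => e * x + (t + 1)) e x := by
    simpa using ((hasDerivAt_id x).const_mul e).add_const (t + 1)
  exact (h1.fun_inv hT.ne').congr_deriv (by ring)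

theorem monotoneOn_transfer_add_gfun (hN : 2 ≤ N) (h : Admissible N e t) {f : ℝ → ℝ}
    (hf : ContinuousOn f (Icc 0 1)) (a b : ℝ)
    (hm : MonotoneOn (fun y => a * f y + b * gfun N e t y) (Icc 0 1)) :
    MonotoneOn (fun y => a * transfer N f y + b * (e * y + (t + 1))⁻¹) (Icc 0 1) :=
  (monotoneOn_transfer_linear_comb hN hf (continuousOn_gfun hN h.e_pos h.t_mem.1) a b hm).congr
    fun x hx => by simp only [transfer_gfun hN h.e_pos h.t_mem.1 hx.1]

/-- Lower bound for the derivative of `U^n f`: if `f' ≥ -c φ`, then `(U^n f)' ≥ -c vⁿ φ`. -/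
theorem monotoneOn_iterate_lower (hN : 2 ≤ N) (h : Admissible N e t) {f : ℝ → ℝ}
    (hf : ContinuousOn f (Icc 0 1)) {c : ℝ} (hc : 0 ≤ c)
    (hm : MonotoneOn (fun y => 1 * f y + c * gfun N e t y) (Icc 0 1)) (n : ℕ) :
    MonotoneOn (fun y => 1 * (transfer N)^[n] f y + c * v N e t ^ n * gfun N e t y) (Icc 0 1) := by
  induction n with
  | zero => simpa using hm
  | succ n ih =>
    have h1 := monotoneOn_transfer_add_gfun hN h (continuousOn_transfer_iterate hN hf n) _ _ ih
    have h2 : MonotoneOn (fun y => v N e t * gfun N e t y - (e * y + (t + 1))⁻¹) (Icc 0 1) := by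
      refine monotoneOn_Icc_of_hasDerivWithinAt (fun x hx =>
        (((hasDerivAt_gfun_phi hN h.e_pos h.t_mem.1 hx).const_mul _).sub
          (hasDerivAt_h h.e_pos h.t_mem.1 hx.1)).hasDerivWithinAt) fun x hx => ?_
      linarith [v_mul_neg_phi_le hN h hx]
    have hv := v_pos hN h
    have hc' : 0 ≤ c * v N e t ^ n := by positivity
    have h3 : MonotoneOn (fun y => c * v N e t ^ n *
        (v N e t * gfun N e t y - (e * y + (t + 1))⁻¹)) (Icc 0 1) :=
      fun _ ha _ hb hab => mul_le_mul_of_nonneg_left (h2 ha hb hab) hc'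
    refine (h1.add h3).congr fun x _ => ?_
    simp only [Function.iterate_succ_apply']
    ring

/-- Upper bound for the derivative of `U^n f`: if `f' ≤ -c φ`, then `(U^n f)' ≤ -c wⁿ φ`. -/
theorem monotoneOn_iterate_upper (hN : 2 ≤ N) (h : Admissible N e t) {f : ℝ → ℝ}
    (hf : ContinuousOn f (Icc 0 1)) {c : ℝ} (hc : 0 ≤ c)
    (hm : MonotoneOn (fun y => (-1) * f y + -c * gfun N e t y) (Icc 0 1)) (n : ℕ) :
    MonotoneOn (fun y => (-1) * (transfer N)^[n] f y + -(c * w N e t ^ n) * gfun N e t y)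
      (Icc 0 1) := by
  induction n with
  | zero => simpa using hm
  | succ n ih =>
    have h1 := monotoneOn_transfer_add_gfun hN h (continuousOn_transfer_iterate hN hf n) _ _ ih
    have h2 : MonotoneOn (fun y => (e * y + (t + 1))⁻¹ - w N e t * gfun N e t y) (Icc 0 1) := by
      refine monotoneOn_Icc_of_hasDerivWithinAt (fun x hx =>
        ((hasDerivAt_h h.e_pos h.t_mem.1 hx.1).sub
          ((hasDerivAt_gfun_phi hN h.e_pos h.t_mem.1 hx).const_mul _)).hasDerivWithinAt)
        fun x hx => ?_
      linarith [le_w_mul_neg_phi hN h hx]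
    have hw := (v_pos hN h).trans (v_lt_w_lt_one hN h).1
    have hc' : 0 ≤ c * w N e t ^ n := by positivity
    have h3 : MonotoneOn (fun y => c * w N e t ^ n *
        ((e * y + (t + 1))⁻¹ - w N e t * gfun N e t y)) (Icc 0 1) :=
      fun _ ha _ hb hab => mul_le_mul_of_nonneg_left (h2 ha hb hab) hc'
    refine (h1.add h3).congr fun x _ => ?_
    simp only [Function.iterate_succ_apply']
    ring

/-- The bounds for `U^(n+1) f`, stated as monotonicity against the logarithm. The lower one loses
nothing in the factor `x + N - 1` because `(x + N - 1) Vφ(x)` is least at `x = 1`. -/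
theorem monotoneOn_iterate_logDist (hN : 2 ≤ N) (h : Admissible N e t) {f : ℝ → ℝ}
    (hf : ContDiffOn ℝ 1 f (Icc 0 1))
    (hpos : ∀ x ∈ Icc (0 : ℝ) 1, 0 < derivWithin f (Icc 0 1) x) (n : ℕ) :
    0 ≤ alpha N e t f ∧ 0 ≤ beta N e t f ∧ 0 ≤ minI (derivWithin f (Icc 0 1)) ∧
    MonotoneOn (fun y => 1 * (transfer N)^[n + 1] f y +
      -(N * (alpha N e t f / beta N e t f) * minI (derivWithin f (Icc 0 1)) * v N e t ^ (n + 1)) *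
        logDist N y) (Icc 0 1) ∧
    MonotoneOn (fun y => (-1) * (transfer N)^[n + 1] f y +
      N * (beta N e t f / alpha N e t f) * maxI (derivWithin f (Icc 0 1)) * w N e t ^ (n + 1) *
        logDist N y) (Icc 0 1) := by
  have hn : (2 : ℝ) ≤ N := by exact_mod_cast hN
  have he := h.e_pos
  have ht := h.t_mem.1
  have h0 : (0 : ℝ) ∈ Icc (0 : ℝ) 1 := by simp
  have h1 : (1 : ℝ) ∈ Icc (0 : ℝ) 1 := by simp
  have hv := v_pos hN h
  have hw := hv.trans (v_lt_w_lt_one hN h).1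
  have hfc := hf.continuousOn
  have hfd : ∀ x ∈ Icc (0 : ℝ) 1, HasDerivWithinAt f (derivWithin f (Icc 0 1) x) (Icc 0 1) x :=
    fun x hx => (hf.differentiableOn one_ne_zero x hx).hasDerivWithinAt
  have hf'c : ContinuousOn (derivWithin f (Icc 0 1)) (Icc 0 1) :=
    hf.continuousOn_derivWithin (uniqueDiffOn_Icc one_pos) le_rfl
  have hquot : ContinuousOn (fun x => -phi N e t x / derivWithin f (Icc 0 1) x) (Icc 0 1) :=
    (continuousOn_phi hN he ht).neg.div hf'c fun x hx => (hpos x hx).ne'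
  have hqpos : ∀ x ∈ Icc (0 : ℝ) 1, 0 < -phi N e t x / derivWithin f (Icc 0 1) x :=
    fun x hx => div_pos (neg_pos.2 (phi_neg hN h hx)) (hpos x hx)
  obtain ⟨xα, hxα, hα, hαle⟩ := exists_minI hquot
  obtain ⟨-, -, -, hβle⟩ := exists_maxI hquot
  obtain ⟨xm, hxm, hmn, hmnle⟩ := exists_minI hf'c
  obtain ⟨-, -, -, hmxle⟩ := exists_maxI hf'c
  change ∀ y ∈ Icc (0 : ℝ) 1, alpha N e t f ≤ _ at hαle
  change ∀ y ∈ Icc (0 : ℝ) 1, _ ≤ beta N e t f at hβle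
  change alpha N e t f = _ at hα
  have hα0 : 0 < alpha N e t f := hα ▸ hqpos xα hxα
  have hβ0 : 0 < beta N e t f := (hqpos 0 h0).trans_le (hβle 0 h0)
  have hmn0 : 0 < minI (derivWithin f (Icc 0 1)) := hmn ▸ hpos xm hxm
  have hαφ : ∀ x ∈ Icc (0 : ℝ) 1, alpha N e t f * derivWithin f (Icc 0 1) x ≤ -phi N e t x :=
    fun x hx => (le_div_iff₀ (hpos x hx)).1 (hαle x hx)
  have hβφ : ∀ x ∈ Icc (0 : ℝ) 1, -phi N e t x ≤ beta N e t f * derivWithin f (Icc 0 1) x :=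
    fun x hx => (div_le_iff₀ (hpos x hx)).1 (hβle x hx)
  generalize alpha N e t f = α at *
  generalize beta N e t f = β at *
  refine ⟨hα0.le, hβ0.le, hmn0.le, ?_, ?_⟩
  · have hbase : MonotoneOn (fun y => 1 * f y + 1 / β * gfun N e t y) (Icc 0 1) := by
      refine monotoneOn_Icc_of_hasDerivWithinAt (fun x hx => ((hfd x hx).const_mul 1).add
        ((hasDerivAt_gfun_phi hN he ht hx).const_mul (1 / β)).hasDerivWithinAt) fun x hx => ?_
      have := (div_le_iff₀' hβ0).2 (hβφ x hx)
      rw [one_mul, one_div_mul_eq_div]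
      rw [neg_div] at this
      linarith
    have hit := monotoneOn_transfer_add_gfun hN h (continuousOn_transfer_iterate hN hfc n) _ _
      (monotoneOn_iterate_lower hN h hfc (one_div_pos.2 hβ0).le hbase n)
    have hlog : MonotoneOn (fun y => -(1 / β * v N e t ^ n) * (e * y + (t + 1))⁻¹ +
        -(N * (α / β) * minI (derivWithin f (Icc 0 1)) * v N e t ^ (n + 1)) * logDist N y)
        (Icc 0 1) := by
      refine monotoneOn_Icc_of_hasDerivWithinAt (fun x hx =>
        (((hasDerivAt_h he ht hx.1).const_mul _).add
          ((hasDerivAt_logDist hN hx.1).const_mul _)).hasDerivWithinAt) fun x hx => ?_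
      have hd := (weight_den_pos hN 0 hx.1).2
      have hmin : α * minI (derivWithin f (Icc 0 1)) * v N e t ≤ e / (e + (t + 1)) ^ 2 := by
        rw [← v_mul_neg_phi_one hN h, mul_comm (v N e t)]
        refine mul_le_mul_of_nonneg_right (le_trans ?_ (hαφ 1 h1)) hv.le
        exact mul_le_mul_of_nonneg_left (hmnle 1 h1) hα0.le
      have hdens : N * (α * minI (derivWithin f (Icc 0 1)) * v N e t) / (x + N - 1) ≤
          e / (e * x + (t + 1)) ^ 2 := by
        rw [div_le_iff₀' hd]
        exact (mul_le_mul_of_nonneg_left hmin N.cast_nonneg).trans (density_mul_V_phi_ge hN h hx)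
      have := mul_le_mul_of_nonneg_left hdens (show 0 ≤ 1 / β * v N e t ^ n by positivity)
      have hrw : N * (α / β) * minI (derivWithin f (Icc 0 1)) * v N e t ^ (n + 1) *
          (1 / (x + N - 1)) = 1 / β * v N e t ^ n *
            (N * (α * minI (derivWithin f (Icc 0 1)) * v N e t) / (x + N - 1)) := by
        ring
      linarith
    refine (hit.add hlog).congr fun x _ => ?_
    simp only [Function.iterate_succ_apply']
    ring
  · have hbase : MonotoneOn (fun y => (-1) * f y + -(1 / α) * gfun N e t y) (Icc 0 1) := by
      refine monotoneOn_Icc_of_hasDerivWithinAt (fun x hx => ((hfd x hx).const_mul (-1)).add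
        ((hasDerivAt_gfun_phi hN he ht hx).const_mul (-(1 / α))).hasDerivWithinAt) fun x hx => ?_
      have := (le_div_iff₀' hα0).2 (hαφ x hx)
      rw [neg_one_mul, neg_mul, one_div_mul_eq_div]
      rw [neg_div] at this
      linarith
    have hit := monotoneOn_iterate_upper hN h hfc (one_div_pos.2 hα0).le hbase (n + 1)
    have hlog : MonotoneOn (fun y => 1 / α * w N e t ^ (n + 1) * gfun N e t y +
        N * (β / α) * maxI (derivWithin f (Icc 0 1)) * w N e t ^ (n + 1) * logDist N y)
        (Icc 0 1) := by
      refine monotoneOn_Icc_of_hasDerivWithinAt (fun x hx =>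
        (((hasDerivAt_gfun_phi hN he ht hx).const_mul _).add
          ((hasDerivAt_logDist hN hx.1).const_mul _)).hasDerivWithinAt) fun x hx => ?_
      have hd := (weight_den_pos hN 0 hx.1).2
      have hmax : -phi N e t x ≤ β * maxI (derivWithin f (Icc 0 1)) :=
        (hβφ x hx).trans (mul_le_mul_of_nonneg_left (hmxle x hx) hβ0.le)
      have hdens : -phi N e t x ≤ N * (β * maxI (derivWithin f (Icc 0 1))) / (x + N - 1) := by
        rw [le_div_iff₀' hd]
        exact mul_le_mul (by linarith [hx.2]) hmax (neg_pos.2 (phi_neg hN h hx)).le N.cast_nonneg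
      have := mul_le_mul_of_nonneg_left hdens (show 0 ≤ 1 / α * w N e t ^ (n + 1) by positivity)
      have hrw : N * (β / α) * maxI (derivWithin f (Icc 0 1)) * w N e t ^ (n + 1) *
          (1 / (x + N - 1)) = 1 / α * w N e t ^ (n + 1) *
            (N * (β * maxI (derivWithin f (Icc 0 1))) / (x + N - 1)) := by
        ring
      linarith
    refine (hit.add hlog).congr fun x _ => ?_
    ring

end Iterates

end RenyiCF

end

open RenyiCF in
theorem theorem3p4 (N : ℕ) (hN : 2 ≤ N) :
    (∃ e t : ℝ, Admissible N e t) ∧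
    ∀ e t : ℝ, Admissible N e t →
      (0 < v N e t ∧ v N e t < w N e t ∧ w N e t < 1) ∧
      ∀ (μ : Measure ℝ), IsProbabilityMeasure μ → μ (Icc 0 1) = 1 → μ ≪ volume →
      ∀ (f : ℝ → ℝ),
        (∀ᵐ x ∂(volume.restrict (Icc (0 : ℝ) 1)),
          f x = (x + N - 1) * (μ.rnDeriv volume x).toReal) →
        ContDiffOn ℝ 1 f (Icc 0 1) →
        (∀ x ∈ Icc (0 : ℝ) 1, 0 < derivWithin f (Icc 0 1) x) →
        ∀ (n : ℕ), 1 ≤ n → ∀ x ∈ Icc (0 : ℝ) 1,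
          Real.log (N / (N - 1)) ^ 2 * (N / 2) * (alpha N e t f / beta N e t f) *
              minI (derivWithin f (Icc 0 1)) * v N e t ^ n * (G N x * (1 - G N x))
            ≤ |μ.real {y ∈ Icc (0 : ℝ) 1 | (renyiMap N)^[n] y < x} - G N x| ∧
          |μ.real {y ∈ Icc (0 : ℝ) 1 | (renyiMap N)^[n] y < x} - G N x|
            ≤ Real.log (N / (N - 1)) ^ 2 * (N / 2) * (beta N e t f / alpha N e t f) *
              maxI (derivWithin f (Icc 0 1)) * w N e t ^ n * (G N x * (1 - G N x)) := by
  refine ⟨exists_admissible N hN, fun e t h => ⟨⟨v_pos hN h, v_lt_w_lt_one hN h⟩, ?_⟩⟩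
  intro μ hprob hμ hac f hfd hf hpos n hn x hx
  have hfc := hf.continuousOn
  obtain ⟨m, rfl⟩ := Nat.exists_eq_add_of_le' hn
  obtain ⟨hα, hβ, hmin, hlow, hup⟩ := monotoneOn_iterate_logDist hN h hf hpos m
  have hq := continuousOn_transfer_iterate hN hfc (m + 1)
  have hone := measureReal_iterate_lt_one (N := N) hμ hn
  rw [measureReal_iterate_lt hN hμ hac hfc hfd (m + 1) (by simp)] at hone
  have h1 := deviation_le_of_monotoneOn hN hq hone _ _ hlow hx
  have h2 := deviation_le_of_monotoneOn hN hq hone _ _ hup hx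
  rw [← measureReal_iterate_lt hN hμ hac hfc hfd (m + 1) hx] at h1 h2
  have hv := v_pos hN h
  have hG := G_mem hN hx
  have hG1 : 0 ≤ 1 - G N x := sub_nonneg.2 hG.2
  have hG0 := hG.1
  have hnonneg : 0 ≤ Real.log (N / (N - 1)) ^ 2 * (N / 2) * (alpha N e t f / beta N e t f) *
      minI (derivWithin f (Icc 0 1)) * v N e t ^ (m + 1) * (G N x * (1 - G N x)) := by
    positivity
  -- the lower bound is nonnegative, so the deviation `μ(Rⁿ < x) - G x` is nonpositive
  rw [abs_of_nonpos (by linarith)]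
  constructor <;> linarith
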